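/- Let $a_i,b_j\in[0,1]$ ($i,j\ge 1$) satisfy $0<a_ib_j<1$ for all $i,j$, and let $\omega_{i,j}$ be independent with $\mathbb P(\omega_{i,j}=k)=(1-a_ib_j)(a_ib_j)^k$, $k=0,1,2,\dots$. Define the growth function by $G(m,n)=\max\{G(m-1,n),G(m,n-1)\}+\omega_{m,n}$ for $m,n\ge1$, with $G(m,0)=0$ and $G(0,n)=0$. Let $m\ge 0$, $0=n_0<n_1<\dots<n_p=N$, and let $h_1\le h_2\le\dots\le h_p$ be integers. Let $\gamma_b$ be a counter-clockwise circle enclosing $1/b_1,\dots,1/b_N$ but none of the points $0,a_1,\dots,a_m$ (which do not lie on it either). (1) Let $\gamma_a$ be a counter-clockwise circle enclosing $a_1,\dots,a_m$ and $0$ and none of the $1/b_k$, whose closed disc is disjoint from that of $\gamma_b$. (If $h_s>-m$ for all $s$, the closed disc of $\gamma_a$ may also leave out $0$.) Then $$\mathbb P\big(G(m,n_1)<h_1,\dots,G(m,n_p)<h_p\big)=\det(I+F)_{N\times N},$$ where, for $i\in(n_{r-1},n_r]$ and $j\in(n_{s-1},n_s]$, $$F(i,j)=\mathbf 1_{\{r>s\}}\frac1{2\pi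 \mathrm i}\oint_{\gamma_b}d\zeta\,\prod_{k=j}^i\Big(\zeta-\frac1{b_k}\Big)^{-1}\zeta^{h_s-h_r}+\frac1{(2\pi \mathrm i)^2}\oint_{\gamma_b}d\zeta\oint_{\gamma_a}dz\,\frac{\prod_{k=1}^{j-1}(z-1/b_k)}{\prod_{k=1}^{i}(\zeta-1/b_k)}\,\frac{z^{h_s-1}}{\zeta^{h_r-1}}\prod_{k=1}^m\frac{1-a_k/\zeta}{1-a_k/z}\,\frac1{z-\zeta}.$$ (2) Write $h(j)=h_k$ for $j\in(n_{k-1},n_k]$. The $N\times N$ matrix $$F_b(i,j)=\frac1{2\pi \mathrm i}\oint_{\gamma_b}dz\,(zb_j)^{h(j)-1}\frac{\prod_{k=1}^{j-1}(z-1/b_k)}{\prod_{k=1}^{i}(z-1/b_k)}\prod_{k=1}^m\frac{1-a_kb_j}{1-a_k/z}$$ is lower triangular with ones on the diagonal. Put $$V(i,j)=\frac1{2\pi \mathrm i}\oint_{\gamma_b}dz\,\frac{\prod_{k=1}^{j-1}(z-1/b_k)}{\prod_{k=1}^{i}(z-1/b_k)}(zb_i)^{1-h(i)}\prod_{k=1}^m\frac{1-a_k/z}{1-a_kb_i},\qquad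 c_j=b_j^{h(j)-1}\prod_{k=1}^m(1-a_kb_j),$$ and, for $i\in(n_{r-1},n_r]$ and $j\in(n_{s-1},n_s]$, $$L(i,j)=\mathbf 1_{\{r>s\}}\,\frac{c_j}{c_i}\,\frac1{2\pi \mathrm i}\oint_{\gamma_b}d\zeta\prod_{k=j}^i\Big(\zeta-\frac1{b_k}\Big)^{-1}\zeta^{h_s-h_r}.$$ Then $$F_b^{-1}=\sum_{l=0}^{p-1}(-L)^l\,V .$$ In particular $F_b^{-1}(i,j)=V(i,j)$ whenever the block $(n_{r-1},n_r]$ of $i$ is not later than the block $(n_{s-1},n_s]$ of $j$ (that is, $r\le s$); for $p=1$ this says $F_b^{-1}=V$. -/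

import Mathlib

open MeasureTheory ProbabilityTheory

noncomputable section

namespace PNG

/-- The growth function `G(m, n)` driven by the weights `w(m, n)`, `m, n ≥ 1`, with boundary values
`G(m, 0) = 0` and `G(0, n) = x_n` for `n ≥ 1`. The values of `x` and `w` at index `0` are not used. -/
def growth (x : ℕ → ℤ) (w : ℕ → ℕ → ℕ) : ℕ → ℕ → ℤ
  | _, 0 => 0
  | 0, n + 1 => x (n + 1)
  | m + 1, n + 1 =>
      max (growth x w m (n + 1)) (growth x w (m + 1) n) + (w (m + 1) (n + 1) : ℤ)

/-- The parameters of the model: `a_i, b_j ∈ [0, 1]` with `0 < a_i b_j < 1` for all `i, j ≥ 1`. -/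
structure Parameters (a b : ℕ → ℝ) : Prop where
  a_mem : ∀ i, 1 ≤ i → a i ∈ Set.Icc (0 : ℝ) 1
  b_mem : ∀ j, 1 ≤ j → b j ∈ Set.Icc (0 : ℝ) 1
  mul_mem : ∀ i j, 1 ≤ i → 1 ≤ j → a i * b j ∈ Set.Ioo (0 : ℝ) 1

/-- The random environment: independent weights `ω_{i,j}`, `i, j ≥ 1`, with
`P(ω_{i,j} = k) = (1 - a_i b_j) (a_i b_j)^k` for `k = 0, 1, 2, …`. -/
structure GeometricEnvironment {Ω : Type*} [MeasurableSpace Ω] (μ : Measure Ω) (a b : ℕ → ℝ)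
    (W : ℕ → ℕ → Ω → ℕ) : Prop where
  measurable : ∀ i j, 1 ≤ i → 1 ≤ j → Measurable (W i j)
  law : ∀ i j, 1 ≤ i → 1 ≤ j → ∀ k : ℕ,
    μ {u | W i j u = k} = ENNReal.ofReal ((1 - a i * b j) * (a i * b j) ^ k)
  indep : iIndepFun (fun q : ℕ+ × ℕ+ => W (q.1 : ℕ) (q.2 : ℕ)) μ

/-- The `r`-th block `(n_{r-1}, n_r]` of row or column indices (blocks are counted by `Fin p`). -/
def block {p : ℕ} (n : Fin (p + 1) → ℕ) (r : Fin p) : Set ℕ :=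
  Set.Ioc (n r.castSucc) (n r.succ)

open Classical in
/-- `h(j) = h_k` for `j ∈ (n_{k-1}, n_k]`. -/
def level {p : ℕ} (n : Fin (p + 1) → ℕ) (h : Fin p → ℤ) (j : ℕ) : ℤ :=
  ∑ k : Fin p, if j ∈ block n k then h k else 0

/-- `∏_{k=1}^{l} (z - 1/b_k)`. -/
def bProd (b : ℕ → ℝ) (l : ℕ) (z : ℂ) : ℂ :=
  ∏ k ∈ Finset.Icc 1 l, (z - 1 / (b k : ℂ))

/-- `(2πi)⁻¹ ∮ f(z) dz` over the counter-clockwise circle with centre `c` and radius `R`. -/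
def contour (c : ℂ) (R : ℝ) (f : ℂ → ℂ) : ℂ :=
  (2 * (Real.pi : ℂ) * Complex.I)⁻¹ * ∮ z in C(c, R), f z

/-- The circle with centre `cb` and radius `Rb` encloses every `1/b_k`, `1 ≤ k ≤ N`, and none of
the points `0, a_1, …, a_m`, which are the other possible poles. -/
structure EnclosesB (a b : ℕ → ℝ) (m N : ℕ) (cb : ℂ) (Rb : ℝ) : Prop where
  pos : 0 < Rb
  inside : ∀ k, 1 ≤ k → k ≤ N → 1 / (b k : ℂ) ∈ Metric.ball cb Rb
  zero_outside : (0 : ℂ) ∉ Metric.closedBall cb Rb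
  outside : ∀ k, 1 ≤ k → k ≤ m → (a k : ℂ) ∉ Metric.closedBall cb Rb

/-- The circle with centre `ca` and radius `Ra` encloses every `a_k`, `1 ≤ k ≤ m`, and none of the
`1/b_k`, `1 ≤ k ≤ N`. It encloses the origin too, except that it may leave the origin outside when
every `h_s > -m`: then the integrands `z^(h_s - 1) ∏ (1 - a_k/z)⁻¹` have no pole at `0`. -/
structure EnclosesA (a b : ℕ → ℝ) (m N : ℕ) {p : ℕ} (h : Fin p → ℤ) (ca : ℂ) (Ra : ℝ) :
    Prop where
  pos : 0 < Ra
  inside : ∀ k, 1 ≤ k → k ≤ m → (a k : ℂ) ∈ Metric.ball ca Ra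
  outside : ∀ k, 1 ≤ k → k ≤ N → 1 / (b k : ℂ) ∉ Metric.closedBall ca Ra
  zero : (0 : ℂ) ∈ Metric.ball ca Ra ∨
    ((0 : ℂ) ∉ Metric.closedBall ca Ra ∧ ∀ s, -(m : ℤ) < h s)

/-- `(2πi)⁻¹ ∮_{γ_b} ∏_{k=j}^{i} (ζ - 1/b_k)⁻¹ ζ^(h_s - h_r) dζ`. -/
def singleIntegral (b : ℕ → ℝ) (cb : ℂ) (Rb : ℝ) (hr hs : ℤ) (i j : ℕ) : ℂ :=
  contour cb Rb fun ζ =>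
    (∏ k ∈ Finset.Icc j i, (ζ - 1 / (b k : ℂ))⁻¹) * ζ ^ (hs - hr)

/-- The double contour integral in the blocks of the kernel: `ζ` runs over `γ_b`, `z` over `γ_a`. -/
def doubleIntegral (a b : ℕ → ℝ) (m : ℕ) (ca : ℂ) (Ra : ℝ) (cb : ℂ) (Rb : ℝ) (hr hs : ℤ)
    (i j : ℕ) : ℂ :=
  contour cb Rb fun ζ => contour ca Ra fun z =>
    bProd b (j - 1) z / bProd b i ζ * (z ^ (hs - 1) / ζ ^ (hr - 1)) *
      (∏ k ∈ Finset.Icc 1 m, (1 - (a k : ℂ) / ζ) / (1 - (a k : ℂ) / z)) * (1 / (z - ζ))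

open Classical in
/-- The entry `F(r, i; s, j)`, which vanishes unless `i` is in block `r` and `j` in block `s`. -/
def kernelBlock (a b : ℕ → ℝ) (m : ℕ) {p : ℕ} (n : Fin (p + 1) → ℕ) (h : Fin p → ℤ)
    (ca : ℂ) (Ra : ℝ) (cb : ℂ) (Rb : ℝ) (r : Fin p) (i : ℕ) (s : Fin p) (j : ℕ) : ℂ :=
  if i ∈ block n r ∧ j ∈ block n s then
    (if s < r then singleIntegral b cb Rb (h r) (h s) i j else 0) +
      doubleIntegral a b m ca Ra cb Rb (h r) (h s) i j
  else 0

/-- The `N × N` matrix `F` assembled from its `p × p` blocks. The row and column indices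
`1, …, N` of the text are `i + 1` and `j + 1` for `i, j : Fin N`. -/
def kernel (a b : ℕ → ℝ) (m N : ℕ) {p : ℕ} (n : Fin (p + 1) → ℕ) (h : Fin p → ℤ)
    (ca : ℂ) (Ra : ℝ) (cb : ℂ) (Rb : ℝ) : Matrix (Fin N) (Fin N) ℂ :=
  Matrix.of fun i j =>
    ∑ r : Fin p, ∑ s : Fin p, kernelBlock a b m n h ca Ra cb Rb r (i + 1) s (j + 1)

/-- The entry `F_b(i, j | x)`, for indices `i, j ≥ 1` and an initial condition `x`. -/
def FbEntry (a b : ℕ → ℝ) (m : ℕ) {p : ℕ} (n : Fin (p + 1) → ℕ) (h : Fin p → ℤ) (x : ℕ → ℤ)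
    (cb : ℂ) (Rb : ℝ) (i j : ℕ) : ℂ :=
  contour cb Rb fun z =>
    (z * (b j : ℂ)) ^ (level n h j - 1) / (z * (b i : ℂ)) ^ (x i) *
      (bProd b (j - 1) z / bProd b i z) *
      ∏ k ∈ Finset.Icc 1 m, (1 - (a k : ℂ) * (b j : ℂ)) / (1 - (a k : ℂ) / z)

/-- The matrix `F_b` for the initial condition `x`. -/
def Fb (a b : ℕ → ℝ) (m N : ℕ) {p : ℕ} (n : Fin (p + 1) → ℕ) (h : Fin p → ℤ) (x : ℕ → ℤ)
    (cb : ℂ) (Rb : ℝ) : Matrix (Fin N) (Fin N) ℂ :=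
  Matrix.of fun i j => FbEntry a b m n h x cb Rb (i + 1) (j + 1)

/-- The entry `V(i, j)`, for indices `i, j ≥ 1`:
`(2πi)⁻¹ ∮_{γ_b} ∏_{k<j} (z - 1/b_k) / ∏_{k≤i} (z - 1/b_k) (z b_i)^(1 - h(i))
∏_k (1 - a_k/z) / (1 - a_k b_i) dz`. -/
def VEntry (a b : ℕ → ℝ) (m : ℕ) {p : ℕ} (n : Fin (p + 1) → ℕ) (h : Fin p → ℤ)
    (cb : ℂ) (Rb : ℝ) (i j : ℕ) : ℂ :=
  contour cb Rb fun z =>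
    bProd b (j - 1) z / bProd b i z * (z * (b i : ℂ)) ^ (1 - level n h i) *
      ∏ k ∈ Finset.Icc 1 m, (1 - (a k : ℂ) / z) / (1 - (a k : ℂ) * (b i : ℂ))

/-- The matrix `V`. -/
def V (a b : ℕ → ℝ) (m N : ℕ) {p : ℕ} (n : Fin (p + 1) → ℕ) (h : Fin p → ℤ)
    (cb : ℂ) (Rb : ℝ) : Matrix (Fin N) (Fin N) ℂ :=
  Matrix.of fun i j => VEntry a b m n h cb Rb (i + 1) (j + 1)

/-- The normalizing factor `c_j = b_j^(h(j) - 1) ∏_{k=1}^m (1 - a_k b_j)`. -/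
def columnFactor (a b : ℕ → ℝ) (m : ℕ) {p : ℕ} (n : Fin (p + 1) → ℕ) (h : Fin p → ℤ)
    (j : ℕ) : ℂ :=
  (b j : ℂ) ^ (level n h j - 1) * ∏ k ∈ Finset.Icc 1 m, (1 - (a k : ℂ) * (b j : ℂ))

open Classical in
/-- The strictly block lower triangular matrix `L` with entries
`(c_j / c_i) (2πi)⁻¹ ∮_{γ_b} ∏_{k=j}^{i} (ζ - 1/b_k)⁻¹ ζ^(h_s - h_r) dζ`
for `i` in block `r`, `j` in block `s`, `r > s`, and `0` elsewhere: the conjugate by the diagonal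
matrix of the `c_j` of the first part of the kernel. -/
def L (a b : ℕ → ℝ) (m N : ℕ) {p : ℕ} (n : Fin (p + 1) → ℕ) (h : Fin p → ℤ)
    (cb : ℂ) (Rb : ℝ) : Matrix (Fin N) (Fin N) ℂ :=
  Matrix.of fun i j =>
    columnFactor a b m n h (j + 1) / columnFactor a b m n h (i + 1) *
      ∑ r : Fin p, ∑ s : Fin p,
        if s < r ∧ (i : ℕ) + 1 ∈ block n r ∧ (j : ℕ) + 1 ∈ block n s then
          singleIntegral b cb Rb (h r) (h s) (i + 1) (j + 1)
        else 0

end PNG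

end

/-! Consider a staircase of cells: the first `j` columns have `m + 1` rows and the others `m`, and
column `i` carries a level `h i`, nondecreasing in `i`. The probability that the growth function at
the top of every column is below its level equals the determinant `transMatrix`, whose columns are
contour integrals over one large circle; this is proved by showing that both sides satisfy the same
recursion. Adding the cell `(m + 1, j + 1)` with `q = a (m + 1) * b (j + 1)`, the memoryless
geometric law gives P(new) = (1 - q) P(old) + q P(new, level of column `j + 1` lowered by one). For
the determinant this is linearity in a column together with 1/(1 - a/z) = 1 + (a/z)/(1 - a/z).

Lowering one level can destroy monotonicity of the levels. It is restored by lowering the columns to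
the left: for the event because the growth function is nondecreasing along a row, for the
determinant by adding multiples of the next column. The recursion ends at a first level `≤ 0`, where
both sides vanish, or at `m = 0` with positive levels, where both are 1. This gives
`measureReal_belowEvent`.

The large circle encloses all poles, so by residues its integral is the sum of those over `γ_b` and
`γ_a`, and the matrix is accordingly `F_b + F_a`. The entries are divided differences at the nodes
`1/b_k`. Row `i` of `V` uses the reciprocal of the function that a column of `F_b` with the same
level uses. The Leibniz rule turns `V * F_b` into divided differences of `z ^ (h_s - h_r)`, that is
into `1 + L` (`V_mul_Fb`). A Newton expansion of the Cauchy kernel turns `V * F_a` into the double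
integral, up to the diagonal conjugation by the `c_j` (`V_mul_entries_a`). Since `V` has determinant
1, the determinant is that of `1 + F`. As `L` is strictly block lower triangular it is nilpotent,
and inverting `1 + L` by a finite geometric series gives the inverse of `F_b`. -/

namespace PNG

/-! ### Elementary rules for normalized circle integrals. -/

section ContourCalculus

variable {c : ℂ} {R : ℝ} {f g : ℂ → ℂ}

lemma contour_congr (hR : 0 < R) (h : Set.EqOn f g (Metric.sphere c R)) :
    contour c R f = contour c R g := by
  unfold contour
  rw [circleIntegral.integral_congr hR.le h]

lemma contour_const_mul (a : ℂ) (f : ℂ → ℂ) :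
    contour c R (fun z => a * f z) = a * contour c R f := by
  unfold contour
  rw [circleIntegral.integral_const_mul]
  ring

lemma contour_mul_const (a : ℂ) (f : ℂ → ℂ) :
    contour c R (fun z => f z * a) = contour c R f * a := by
  simp_rw [mul_comm _ a]
  exact contour_const_mul a f

lemma contour_add (hR : 0 < R) (hf : ContinuousOn f (Metric.sphere c R))
    (hg : ContinuousOn g (Metric.sphere c R)) :
    contour c R (fun z => f z + g z) = contour c R f + contour c R g := by
  unfold contour
  rw [circleIntegral.integral_add (hf.circleIntegrable hR.le) (hg.circleIntegrable hR.le)]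
  ring

lemma contour_sub (hR : 0 < R) (hf : ContinuousOn f (Metric.sphere c R))
    (hg : ContinuousOn g (Metric.sphere c R)) :
    contour c R (fun z => f z - g z) = contour c R f - contour c R g := by
  unfold contour
  rw [circleIntegral.integral_sub (hf.circleIntegrable hR.le) (hg.circleIntegrable hR.le)]
  ring

lemma contour_sum (hR : 0 < R) {ι : Type*} (s : Finset ι) (F : ι → ℂ → ℂ)
    (hF : ∀ i ∈ s, ContinuousOn (F i) (Metric.sphere c R)) :
    contour c R (fun z => ∑ i ∈ s, F i z) = ∑ i ∈ s, contour c R (F i) := by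
  unfold contour
  rw [circleIntegral.integral_fun_sum fun i hi => (hF i hi).circleIntegrable hR.le,
    Finset.mul_sum]

lemma contour_zero : contour c R (fun _ => 0) = 0 := by
  simp [contour, circleIntegral]

lemma contour_eq_zero (hR : 0 < R) (hf : DifferentiableOn ℂ f (Metric.closedBall c R)) :
    contour c R f = 0 := by
  unfold contour
  rw [(hf.diffContOnCl_ball subset_rfl).circleIntegral_eq_zero hR.le, mul_zero]

lemma contour_inv_sub_mul {w : ℂ} (hw : w ∈ Metric.ball c R)
    (hf : DifferentiableOn ℂ f (Metric.closedBall c R)) :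
    contour c R (fun z => (z - w)⁻¹ * f z) = f w := by
  have h := (hf.diffContOnCl_ball subset_rfl).two_pi_i_inv_smul_circleIntegral_sub_inv_smul hw
  simpa [contour] using h

lemma contour_inv_sub_of_mem {w : ℂ} (hw : w ∈ Metric.ball c R) :
    contour c R (fun z => (z - w)⁻¹) = 1 := by
  have := contour_inv_sub_mul (f := fun _ => 1) hw (differentiableOn_const _)
  simpa using this

lemma contour_inv_sub_of_notMem (hR : 0 < R) {w : ℂ} (hw : w ∉ Metric.closedBall c R) :
    contour c R (fun z => (z - w)⁻¹) = 0 := by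
  refine contour_eq_zero hR fun z hz => ?_
  have : z - w ≠ 0 := sub_ne_zero.2 fun h => hw (h ▸ hz)
  fun_prop (disch := assumption)

lemma contour_inv_sub_pow (w : ℂ) {n : ℕ} (hn : n ≠ 1) :
    contour c R (fun z => (z - w)⁻¹ ^ n) = 0 := by
  have h := circleIntegral.integral_sub_zpow_of_ne (n := -(n : ℤ)) (by omega) c w R
  simp only [zpow_neg, zpow_natCast] at h
  simp [contour, inv_pow, h]

end ContourCalculus

/-! ### Residues of rational functions, uniformly in the circle. -/

section Residues

lemma continuousOn_prod_inv_sub {c : ℂ} {R : ℝ} {s : Multiset ℂ}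
    (hs : ∀ p ∈ s, p ∉ Metric.sphere c R) :
    ContinuousOn (fun z : ℂ => (s.map fun p => (z - p)⁻¹).prod) (Metric.sphere c R) := by
  induction s using Multiset.induction_on with
  | empty => simpa using continuousOn_const
  | cons p t ih =>
    simp only [Multiset.map_cons, Multiset.prod_cons]
    refine ContinuousOn.mul (ContinuousOn.inv₀ (by fun_prop) fun z hz h => ?_)
      (ih fun q hq => hs q (Multiset.mem_cons_of_mem hq))
    rw [sub_eq_zero] at h
    exact hs p (Multiset.mem_cons_self p t) (h ▸ hz)

/-- Partial fractions: two distinct poles are separated until only powers of one factor remain. One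
`ρ` serves all circles, so integrals over different circles can be compared; its total is minus the
residue at infinity, nonzero only for a single factor. -/
lemma exists_residues_one (S : Finset ℂ) (n : ℕ) : ∀ s : Multiset ℂ, s.card = n + 1 →
    (∀ p ∈ s, p ∈ S) → ∃ ρ : ℂ → ℂ,
      (∀ (c : ℂ) (R : ℝ), 0 < R → (∀ p ∈ S, p ∉ Metric.sphere c R) →
        contour c R (fun z => (s.map fun p => (z - p)⁻¹).prod) =
          ∑ p ∈ S, (Metric.ball c R).indicator ρ p) ∧
      ∑ p ∈ S, ρ p = if n = 0 then 1 else 0 := by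
  classical
  induction n with
  | zero =>
    intro s hs hS
    obtain ⟨p, rfl⟩ := Multiset.card_eq_one.1 hs
    have hp : p ∈ S := hS p (by simp)
    refine ⟨Pi.single p 1, fun c R hR hc => ?_, by simp [hp]⟩
    rw [Finset.sum_eq_single p (fun q _ hq => by simp [Set.indicator, hq])
      (fun h => absurd hp h)]
    simp only [Multiset.map_singleton, Multiset.prod_singleton]
    by_cases hb : p ∈ Metric.ball c R
    · rw [contour_inv_sub_of_mem hb]; simp [Set.indicator_of_mem hb]
    · rw [Set.indicator_of_notMem hb, contour_inv_sub_of_notMem hR]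
      intro h
      rw [← Metric.ball_union_sphere] at h
      exact h.elim hb (hc p hp)
  | succ n ih =>
    intro s hs hS
    obtain ⟨p, hp⟩ := Multiset.card_pos_iff_exists_mem.1 (show 0 < s.card by omega)
    obtain ⟨t, rfl⟩ := Multiset.exists_cons_of_mem hp
    by_cases hall : ∀ q ∈ t, q = p
    · have ht : t = Multiset.replicate (n + 1) p :=
        Multiset.eq_replicate.2 ⟨by simpa using hs, hall⟩
      -- A power of order at least two of a single factor has a primitive, hence no residue.
      refine ⟨0, fun c R hR hc => ?_, by simp⟩
      have := contour_inv_sub_pow (c := c) (R := R) p (n := n + 2) (by omega)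
      subst ht
      simp only [Multiset.map_cons, Multiset.map_replicate, Multiset.prod_cons,
        Multiset.prod_replicate, ← pow_succ']
      rw [this]
      simp
    · push Not at hall
      obtain ⟨q, hq, hqp⟩ := hall
      obtain ⟨u, rfl⟩ := Multiset.exists_cons_of_mem hq
      have hu : u.card = n := by simpa using hs
      obtain ⟨ρ₁, h₁, h₁'⟩ := ih (p ::ₘ u) (by simp [hu]) fun x hx => hS x (by
        simp only [Multiset.mem_cons] at hx ⊢; tauto)
      obtain ⟨ρ₂, h₂, h₂'⟩ := ih (q ::ₘ u) (by simp [hu]) fun x hx => hS x (by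
        simp only [Multiset.mem_cons] at hx ⊢; tauto)
      refine ⟨fun x => (p - q)⁻¹ * (ρ₁ x - ρ₂ x), fun c R hR hc => ?_, by
        rw [← Finset.mul_sum, Finset.sum_sub_distrib, h₁', h₂']; simp⟩
      have hne : ∀ x ∈ S, ∀ z ∈ Metric.sphere c R, z - x ≠ 0 := fun x hx z hz h =>
        hc x hx (sub_eq_zero.1 h ▸ hz)
      have hpq : p - q ≠ 0 := sub_ne_zero.2 (Ne.symm hqp)
      have hpS : p ∈ S := hS p (by simp)
      have hqS : q ∈ S := hS q (by simp)
      -- 1/((z - p)(z - q)) = (1/(z - p) - 1/(z - q))/(p - q); the two totals given by induction are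
      -- equal, so they cancel in the difference.
      rw [contour_congr (g := fun z => (p - q)⁻¹ *
        (((p ::ₘ u).map fun p => (z - p)⁻¹).prod - ((q ::ₘ u).map fun p => (z - p)⁻¹).prod)) hR,
        contour_const_mul, contour_sub hR, h₁ c R hR hc, h₂ c R hR hc, ← Finset.sum_sub_distrib,
        Finset.mul_sum]
      · refine Finset.sum_congr rfl fun x _ => ?_
        by_cases hx : x ∈ Metric.ball c R <;> simp [Set.indicator, hx]
      · exact continuousOn_prod_inv_sub fun x hx => hc x (hS x (by
          simp only [Multiset.mem_cons] at hx ⊢; tauto))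
      · exact continuousOn_prod_inv_sub fun x hx => hc x (hS x (by
          simp only [Multiset.mem_cons] at hx ⊢; tauto))
      · intro z hz
        have hzp := hne p hpS z hz
        have hzq := hne q hqS z hz
        simp only [Multiset.map_cons, Multiset.prod_cons]
        field_simp
        ring

/-- The residue theorem for a rational function whose poles lie in `S`. -/
lemma exists_residues (S : Finset ℂ) (s : Multiset ℂ) (hS : ∀ p ∈ s, p ∈ S) (P : Polynomial ℂ) :
    ∃ ρ : ℂ → ℂ,
      (∀ (c : ℂ) (R : ℝ), 0 < R → (∀ p ∈ S, p ∉ Metric.sphere c R) →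
        contour c R (fun z => P.eval z * (s.map fun p => (z - p)⁻¹).prod) =
          ∑ p ∈ S, (Metric.ball c R).indicator ρ p) ∧
      (P.degree < ((s.card - 1 : ℕ) : WithBot ℕ) → ∑ p ∈ S, ρ p = 0) := by
  classical
  induction s using Multiset.induction_on generalizing P with
  | empty =>
    refine ⟨0, fun c R hR _ => ?_, by simp⟩
    simp only [Multiset.map_zero, Multiset.prod_zero, mul_one]
    rw [contour_eq_zero hR P.differentiable.differentiableOn]
    simp
  | cons p t ih =>
    have hpS : p ∈ S := hS p (by simp)
    -- Divide with remainder, P = P(p) + (X - p) Q: the constant goes with all the factors, Q with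
    -- the factors other than p.
    obtain ⟨ρ₁, h₁, h₁'⟩ := ih (fun q hq => hS q (by simp [hq]))
      (P /ₘ (Polynomial.X - Polynomial.C p))
    obtain ⟨ρ₂, h₂, h₂'⟩ := exists_residues_one S t.card (p ::ₘ t) (by simp) hS
    refine ⟨fun x => P.eval p * ρ₂ x + ρ₁ x, fun c R hR hc => ?_, fun hP => ?_⟩
    · have hne : ∀ x ∈ S, ∀ z ∈ Metric.sphere c R, z - x ≠ 0 := fun x hx z hz h =>
        hc x hx (sub_eq_zero.1 h ▸ hz)
      have hcs : ContinuousOn (fun z : ℂ => ((p ::ₘ t).map fun p => (z - p)⁻¹).prod)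
          (Metric.sphere c R) := continuousOn_prod_inv_sub fun x hx => hc x (hS x hx)
      have hct : ContinuousOn (fun z : ℂ => (t.map fun p => (z - p)⁻¹).prod)
          (Metric.sphere c R) :=
        continuousOn_prod_inv_sub fun x hx => hc x (hS x (by simp [hx]))
      rw [contour_congr (g := fun z => P.eval p * ((p ::ₘ t).map fun p => (z - p)⁻¹).prod +
        (P /ₘ (Polynomial.X - Polynomial.C p)).eval z * (t.map fun p => (z - p)⁻¹).prod) hR,
        contour_add hR (by exact continuousOn_const.mul hcs)
          (by exact (Polynomial.continuous _).continuousOn.mul hct), contour_const_mul, h₂ c R hR hc,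
        h₁ c R hR hc, Finset.mul_sum, ← Finset.sum_add_distrib]
      · refine Finset.sum_congr rfl fun x _ => ?_
        by_cases hx : x ∈ Metric.ball c R <;> simp [Set.indicator, hx]
      · intro z hz
        have hz' := hne p hpS z hz
        have hdiv := congrArg (Polynomial.eval z)
          (Polynomial.modByMonic_add_div P (Polynomial.X - Polynomial.C p))
        simp only [Polynomial.modByMonic_X_sub_C_eq_C_eval, Polynomial.eval_add,
          Polynomial.eval_C, Polynomial.eval_mul, Polynomial.eval_sub, Polynomial.eval_X] at hdiv
        simp only [Multiset.map_cons, Multiset.prod_cons]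
        rw [← hdiv]
        field_simp
    · rw [Finset.sum_add_distrib, ← Finset.mul_sum, h₂']
      simp only [Multiset.card_cons, Nat.add_sub_cancel] at hP
      by_cases hP0 : P = 0
      · subst hP0
        simp only [Polynomial.zero_divByMonic, Polynomial.degree_zero] at h₁' ⊢
        simp [h₁' (WithBot.bot_lt_coe _)]
      have ht : t.card ≠ 0 := by
        rintro h0
        rw [h0, Nat.cast_zero, Polynomial.degree_eq_natDegree hP0] at hP
        exact absurd (by exact_mod_cast hP) (Nat.not_lt_zero P.natDegree)
      rw [if_neg ht, mul_zero, zero_add]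
      apply h₁'
      -- Constants are treated apart because the subtractions are truncated: with one remaining
      -- factor, the required `0 - 1 < 1 - 1` fails, although the quotient is zero.
      by_cases hPd : P.natDegree = 0
      · have : P /ₘ (Polynomial.X - Polynomial.C p) = 0 := by
          rw [Polynomial.divByMonic_eq_zero_iff (Polynomial.monic_X_sub_C p),
            Polynomial.degree_X_sub_C, Polynomial.degree_eq_natDegree hP0, hPd]
          exact_mod_cast zero_lt_one
        rw [this, Polynomial.degree_zero]
        exact WithBot.bot_lt_coe _
      · refine Polynomial.degree_le_natDegree.trans_lt ?_
        rw [Polynomial.natDegree_divByMonic _ (Polynomial.monic_X_sub_C p),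
          Polynomial.natDegree_X_sub_C]
        rw [Polynomial.degree_eq_natDegree hP0] at hP
        have : P.natDegree < t.card := by exact_mod_cast hP
        exact_mod_cast (by omega : P.natDegree - 1 < t.card - 1)

end Residues

/-! ### Divided differences as triangular matrices. -/

section DividedDifferences

/-- The divided difference matrix entry `(2πi)⁻¹ ∮ f(z) ∏_{l<k} (z - 1/b_l) / ∏_{l≤i} (z - 1/b_l)`. -/
noncomputable def divDiff (b : ℕ → ℝ) (c : ℂ) (R : ℝ) (f : ℂ → ℂ) (i k : ℕ) : ℂ :=
  contour c R fun z => f z * (bProd b (k - 1) z / bProd b i z)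

variable {b : ℕ → ℝ} {c : ℂ} {R : ℝ}

lemma bProd_succ (l : ℕ) (z : ℂ) : bProd b (l + 1) z = bProd b l z * (z - 1 / (b (l + 1) : ℂ)) := by
  unfold bProd
  rw [Finset.prod_Icc_succ_top (by omega)]

lemma bProd_zero (z : ℂ) : bProd b 0 z = 1 := by simp [bProd]

lemma differentiable_bProd (l : ℕ) : Differentiable ℂ (bProd b l) := by
  unfold bProd
  fun_prop

lemma bProd_ne_zero {l : ℕ} {z : ℂ} (h : ∀ k, 1 ≤ k → k ≤ l → z ≠ 1 / (b k : ℂ)) :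
    bProd b l z ≠ 0 := by
  unfold bProd
  rw [Finset.prod_ne_zero_iff]
  intro k hk
  rw [Finset.mem_Icc] at hk
  exact sub_ne_zero.2 (h k hk.1 hk.2)

lemma bProd_mul_prod_Ioc {k i : ℕ} (h : k ≤ i) (z : ℂ) :
    bProd b k z * ∏ l ∈ Finset.Ioc k i, (z - 1 / (b l : ℂ)) = bProd b i z := by
  induction i, h using Nat.le_induction with
  | base => simp
  | succ i hi ih => rw [Finset.prod_Ioc_succ_top (by omega), ← mul_assoc, ih, bProd_succ]

/-- The nodes `1/b_1, …, 1/b_N` lie inside the circle. -/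
def NodesInside (b : ℕ → ℝ) (N : ℕ) (c : ℂ) (R : ℝ) : Prop :=
  ∀ k, 1 ≤ k → k ≤ N → 1 / (b k : ℂ) ∈ Metric.ball c R

lemma NodesInside.bProd_ne_zero {N : ℕ} (hb : NodesInside b N c R) {l : ℕ} (hl : l ≤ N) {z : ℂ}
    (hz : z ∈ Metric.sphere c R) : bProd b l z ≠ 0 :=
  PNG.bProd_ne_zero fun k hk hkl h => by
    have h1 := hb k hk (hkl.trans hl)
    rw [← h, Metric.mem_ball, Metric.mem_sphere.1 hz] at h1
    exact lt_irrefl _ h1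

lemma NodesInside.continuousOn_div {N : ℕ} (hb : NodesInside b N c R) {i : ℕ} (hi : i ≤ N)
    (k : ℕ) : ContinuousOn (fun z => bProd b k z / bProd b i z) (Metric.sphere c R) :=
  (differentiable_bProd k).continuous.continuousOn.div
    (differentiable_bProd i).continuous.continuousOn fun _ hz => hb.bProd_ne_zero hi hz

/-- The numerator cancels every factor of the denominator, which leaves a holomorphic integrand. -/
lemma divDiff_of_lt {N : ℕ} (hR : 0 < R) (hb : NodesInside b N c R) {f : ℂ → ℂ}
    (hf : DifferentiableOn ℂ f (Metric.closedBall c R)) {i k : ℕ} (hik : i < k) (hk : i ≤ N) :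
    divDiff b c R f i k = 0 := by
  unfold divDiff
  rw [contour_congr (g := fun z => f z * ∏ l ∈ Finset.Ioc i (k - 1), (z - 1 / (b l : ℂ))) hR]
  · exact contour_eq_zero hR (hf.mul (by fun_prop))
  · intro z hz
    have := hb.bProd_ne_zero hk hz
    simp only [← bProd_mul_prod_Ioc (show i ≤ k - 1 by omega) z]
    field_simp

lemma divDiff_self {N : ℕ} (hR : 0 < R) (hb : NodesInside b N c R) {f : ℂ → ℂ}
    (hf : DifferentiableOn ℂ f (Metric.closedBall c R)) {i : ℕ} (hi : 1 ≤ i) (hiN : i ≤ N) :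
    divDiff b c R f i i = f (1 / (b i : ℂ)) := by
  rw [← contour_inv_sub_mul (hb i hi hiN) hf]
  refine contour_congr hR fun z hz => ?_
  obtain ⟨i, rfl⟩ := Nat.exists_eq_add_of_le' hi
  have h1 := hb.bProd_ne_zero hiN hz
  rw [bProd_succ] at h1
  have h2 := left_ne_zero_of_mul h1
  have h3 := right_ne_zero_of_mul h1
  simp only [bProd_succ, Nat.add_sub_cancel, div_eq_mul_inv, mul_inv_rev]
  rw [mul_comm (z - _)⁻¹, ← mul_assoc (bProd b i z), mul_inv_cancel₀ h2, one_mul, mul_comm]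

/-- What remains is the reciprocal of at least two linear factors with all its poles inside, so the
residues sum to zero. -/
lemma divDiff_one_of_lt {N : ℕ} (hR : 0 < R) (hb : NodesInside b N c R) {i k : ℕ} (hk : 1 ≤ k)
    (hki : k < i) (hiN : i ≤ N) : divDiff b c R (fun _ => 1) i k = 0 := by
  classical
  set s : Multiset ℂ := (Finset.Ioc (k - 1) i).val.map fun l => 1 / (b l : ℂ) with hs
  have hsb : ∀ p ∈ s, p ∈ Metric.ball c R := by
    intro p hp
    obtain ⟨l, hl, rfl⟩ := Multiset.mem_map.1 hp
    rw [Finset.mem_val, Finset.mem_Ioc] at hl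
    exact hb l (by omega) (by omega)
  obtain ⟨ρ, h1, h2⟩ := exists_residues s.toFinset s (fun p hp => by simpa using hp) 1
  have h3 := h1 c R hR fun p hp h => by
    have := hsb p (by simpa using hp)
    rw [Metric.mem_ball, Metric.mem_sphere.1 h] at this
    exact lt_irrefl _ this
  rw [Finset.sum_congr rfl fun p hp => Set.indicator_of_mem (hsb p (by simpa using hp)) ρ,
    h2] at h3
  · rw [← h3]
    refine contour_congr hR fun z hz => ?_
    have h4 := hb.bProd_ne_zero (show k - 1 ≤ N by omega) hz
    simp only [← bProd_mul_prod_Ioc (show k - 1 ≤ i by omega) z, hs, Multiset.map_map,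
      Polynomial.eval_one, one_mul, Function.comp_def]
    rw [← Finset.prod_eq_multiset_prod, Finset.prod_inv_distrib, div_mul_eq_div_div, div_self h4,
      one_div]
  · rw [Polynomial.degree_one, hs, Multiset.card_map, Finset.card_val, Nat.card_Ioc]
    exact_mod_cast (by omega : 0 < i - (k - 1) - 1)

/-- Newton interpolation: `f / ∏_{l≤i} (z - 1/b_l)` is the sum of its Newton form and of a function
holomorphic in the disc. -/
lemma exists_newton {N : ℕ} (hb : NodesInside b N c R) {f : ℂ → ℂ}
    (hf : DifferentiableOn ℂ f (Metric.closedBall c R)) {i : ℕ} (hiN : i ≤ N) :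
    ∃ (e : ℕ → ℂ) (r : ℂ → ℂ), DifferentiableOn ℂ r (Metric.closedBall c R) ∧
      ∀ z ∈ Metric.sphere c R,
        f z / bProd b i z = ∑ k ∈ Finset.Icc 1 i, e k / bProd b k z + r z := by
  induction i generalizing f with
  | zero => exact ⟨0, f, hf, fun z _ => by simp [bProd_zero]⟩
  | succ i ih =>
    set w : ℂ := 1 / (b (i + 1) : ℂ) with hw
    have hwb : w ∈ Metric.ball c R := hb (i + 1) (by omega) hiN
    -- Peel off the last node `w`: f = f(w) + (z - w) `dslope f w`, and the slope is again
    -- holomorphic in the disc.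
    obtain ⟨e, r, hr, h⟩ := ih ((Complex.differentiableOn_dslope
      (Filter.mem_of_superset (Metric.isOpen_ball.mem_nhds hwb) Metric.ball_subset_closedBall)).2
        hf) (by omega)
    refine ⟨Function.update e (i + 1) (f w), r, hr, fun z hz => ?_⟩
    rw [Finset.sum_Icc_succ_top (by omega), Function.update_self,
      Finset.sum_congr rfl fun k hk => by
        rw [Function.update_of_ne (by rw [Finset.mem_Icc] at hk; omega)]]
    have h1 := hb.bProd_ne_zero hiN hz
    rw [bProd_succ] at h1
    have h2 := left_ne_zero_of_mul h1
    have h3 : z - w ≠ 0 := right_ne_zero_of_mul h1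
    have h4 := h z hz
    have h5 : dslope f w z = (f z - f w) / (z - w) := by
      rw [dslope_of_ne _ (sub_ne_zero.1 h3), slope_def_field]
    rw [h5] at h4
    rw [add_right_comm, ← h4, bProd_succ, ← hw]
    field_simp
    ring

/-- The Leibniz rule for divided differences, in matrix form. -/
lemma sum_divDiff_mul_divDiff {N : ℕ} (hR : 0 < R) (hb : NodesInside b N c R) {f g : ℂ → ℂ}
    (hf : DifferentiableOn ℂ f (Metric.closedBall c R))
    (hg : DifferentiableOn ℂ g (Metric.closedBall c R)) {i : ℕ} (hiN : i ≤ N) (j : ℕ) :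
    ∑ k ∈ Finset.Icc 1 i, divDiff b c R f i k * divDiff b c R g k j =
      divDiff b c R (fun z => f z * g z) i j := by
  obtain ⟨e, r, hr, h⟩ := exists_newton hb hf hiN
  -- The Newton coefficients `e` do not depend on `g`, and the holomorphic remainder integrates to
  -- zero.
  have key : ∀ {g : ℂ → ℂ}, DifferentiableOn ℂ g (Metric.closedBall c R) → ∀ j,
      divDiff b c R (fun z => f z * g z) i j =
        ∑ k ∈ Finset.Icc 1 i, e k * divDiff b c R g k j := by
    intro g hg j
    have hgs := hg.continuousOn.mono Metric.sphere_subset_closedBall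
    unfold divDiff
    rw [contour_congr (g := fun z => (∑ k ∈ Finset.Icc 1 i, e k *
      (g z * (bProd b (j - 1) z / bProd b k z))) + r z * g z * bProd b (j - 1) z) hR,
      contour_add hR, contour_sum hR,
      contour_eq_zero (f := fun z => r z * g z * bProd b (j - 1) z) hR ((hr.mul hg).mul (differentiable_bProd _).differentiableOn), add_zero]
    · exact Finset.sum_congr rfl fun k _ => contour_const_mul _ _
    · exact fun k hk => continuousOn_const.mul
        (hgs.mul (hb.continuousOn_div (by rw [Finset.mem_Icc] at hk; omega) _))
    · exact continuousOn_finsetSum _ fun k hk => continuousOn_const.mul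
        (hgs.mul (hb.continuousOn_div (by rw [Finset.mem_Icc] at hk; omega) _))
    · exact (((hr.mul hg).mul (differentiable_bProd _).differentiableOn).continuousOn).mono
        Metric.sphere_subset_closedBall
    · intro z hz
      have : f z * g z * (bProd b (j - 1) z / bProd b i z) =
          f z / bProd b i z * (g z * bProd b (j - 1) z) := by ring
      simp only [this, h z hz, add_mul, Finset.sum_mul]
      congr 1
      · exact Finset.sum_congr rfl fun k _ => by ring
      · ring
  rw [key hg]
  refine Finset.sum_congr rfl fun k hk => ?_
  rw [Finset.mem_Icc] at hk
  congr 1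
  -- For `g = 1` the divided difference matrix is the identity, which identifies `e k` as the
  -- divided difference of `f`.
  have h1 := key (g := fun _ => 1) (differentiableOn_const _) k
  simp only [mul_one] at h1
  rw [h1, Finset.sum_eq_single k]
  · rw [divDiff_self hR hb (differentiableOn_const _) hk.1 (by omega), mul_one]
  · intro l hl hlk
    rw [Finset.mem_Icc] at hl
    rcases lt_or_gt_of_ne hlk with h2 | h2
    · rw [divDiff_of_lt hR hb (differentiableOn_const _) h2 (by omega), mul_zero]
    · rw [divDiff_one_of_lt hR hb hk.1 h2 (by omega), mul_zero]
  · exact fun h => absurd (Finset.mem_Icc.2 hk) h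

end DividedDifferences

/-! ### Entries of the determinantal formula and their recursions. -/

section Entries

/-- The part `z^(h-1) ∏ (1 - a_k/z)⁻¹` of the integrands that does not involve the `b_k`. -/
noncomputable def core (a : ℕ → ℝ) (m : ℕ) (h : ℤ) (z : ℂ) : ℂ :=
  z ^ (h - 1) / ∏ k ∈ Finset.Icc 1 m, (1 - (a k : ℂ) / z)

/-- The normalizing factor `b_j^(h-1) ∏ (1 - a_k b_j)`. -/
noncomputable def coeff (a b : ℕ → ℝ) (m : ℕ) (h : ℤ) (j : ℕ) : ℂ :=
  (b j : ℂ) ^ (h - 1) * ∏ k ∈ Finset.Icc 1 m, (1 - (a k : ℂ) * (b j : ℂ))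

/-- The entry of the determinantal formula for the column `j` with `m` rows and level `h`. -/
noncomputable def entry (a b : ℕ → ℝ) (c : ℂ) (R : ℝ) (m : ℕ) (h : ℤ) (i j : ℕ) : ℂ :=
  coeff a b m h j * divDiff b c R (core a m h) i j

/-- The point `z` avoids `0, a_1, …, a_m`. -/
structure Regular (a : ℕ → ℝ) (m : ℕ) (z : ℂ) : Prop where
  ne_zero : z ≠ 0
  ne : ∀ k, 1 ≤ k → k ≤ m → z ≠ (a k : ℂ)

variable {a b : ℕ → ℝ} {m N : ℕ} {h : ℤ} {z c : ℂ} {R : ℝ}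

lemma Regular.one_sub_ne_zero (hz : Regular a m z) {k : ℕ} (hk : k ∈ Finset.Icc 1 m) :
    1 - (a k : ℂ) / z ≠ 0 := by
  rw [Finset.mem_Icc] at hk
  have h0 := hz.ne_zero
  have h1 := hz.ne k hk.1 hk.2
  intro h
  rw [sub_eq_zero, eq_div_iff h0, one_mul] at h
  exact h1 h

lemma Regular.prod_ne_zero (hz : Regular a m z) :
    ∏ k ∈ Finset.Icc 1 m, (1 - (a k : ℂ) / z) ≠ 0 :=
  Finset.prod_ne_zero_iff.2 fun _ hk => hz.one_sub_ne_zero hk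

lemma differentiableOn_core {s : Set ℂ} (hs : ∀ z ∈ s, Regular a m z) :
    DifferentiableOn ℂ (core a m h) s := by
  intro z hz
  have h0 := (hs z hz).ne_zero
  have h1 := (hs z hz).prod_ne_zero
  refine DifferentiableAt.differentiableWithinAt (DifferentiableAt.div ?_ ?_ h1)
  · exact differentiableAt_id.zpow (Or.inl h0)
  · exact DifferentiableAt.fun_finsetProd fun k _ => by fun_prop (disch := assumption)

lemma Parameters.b_pos (hab : Parameters a b) {j : ℕ} (hj : 1 ≤ j) : 0 < b j := by
  have h1 := (hab.mul_mem 1 j le_rfl hj).1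
  have h2 := (hab.b_mem j hj).1
  rcases h2.eq_or_lt with h3 | h3
  · rw [← h3, mul_zero] at h1
    exact absurd h1 (lt_irrefl _)
  · exact h3

lemma Parameters.b_ne_zero (hab : Parameters a b) {j : ℕ} (hj : 1 ≤ j) : (b j : ℂ) ≠ 0 :=
  Complex.ofReal_ne_zero.2 (hab.b_pos hj).ne'

lemma Parameters.one_sub_ne_zero (hab : Parameters a b) {i j : ℕ} (hi : 1 ≤ i) (hj : 1 ≤ j) :
    1 - (a i : ℂ) * (b j : ℂ) ≠ 0 := by
  have h := (hab.mul_mem i j hi hj).2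
  rw [← Complex.ofReal_mul, sub_ne_zero, Ne, eq_comm, Complex.ofReal_eq_one]
  exact h.ne

lemma coeff_ne_zero (hab : Parameters a b) {j : ℕ} (hj : 1 ≤ j) : coeff a b m h j ≠ 0 :=
  mul_ne_zero (zpow_ne_zero _ (hab.b_ne_zero hj)) (Finset.prod_ne_zero_iff.2 fun _ hk =>
    hab.one_sub_ne_zero (Finset.mem_Icc.1 hk).1 hj)

/-- This is 1/(1 - q) = 1 + q/(1 - q) with q = a/z; the factor 1/z lowers the level by one. -/
lemma core_succ (hz : Regular a (m + 1) z) :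
    core a (m + 1) h z = core a m h z + a (m + 1) * core a (m + 1) (h - 1) z := by
  have h0 := hz.ne_zero
  have h1 := hz.one_sub_ne_zero (k := m + 1) (by simp)
  have h2 := hz.prod_ne_zero
  unfold core
  rw [Finset.prod_Icc_succ_top (by omega)] at h2 ⊢
  have h3 := left_ne_zero_of_mul h2
  have h4 : z ^ (h - 1) = z ^ (h - 1 - 1) * z := by
    rw [← zpow_add_one₀ h0]; congr 1; ring
  rw [h4]
  generalize ∏ k ∈ Finset.Icc 1 m, (1 - (a k : ℂ) / z) = p at *
  field_simp
  have h5 : z - a (m + 1) ≠ 0 := sub_ne_zero.2 (hz.ne (m + 1) (by omega) le_rfl)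
  field_simp
  ring

lemma coeff_succ : coeff a b (m + 1) h j = coeff a b m h j * (1 - a (m + 1) * b j) := by
  unfold coeff
  rw [Finset.prod_Icc_succ_top (by omega), mul_assoc]

lemma coeff_mul_b {j : ℕ} (hb : (b j : ℂ) ≠ 0) : b j * coeff a b m (h - 1) j = coeff a b m h j := by
  unfold coeff
  rw [← mul_assoc, mul_comm (b j : ℂ), ← zpow_add_one₀ hb, sub_add_cancel]

/-- With the normalization `coeff`, `core_succ` takes the form of the memoryless recursion of a
geometric variable of parameter `a (m + 1) * b j`. -/
lemma entry_succ (hab : Parameters a b) (hR : 0 < R) (hb : NodesInside b N c R)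
    (hz : ∀ z ∈ Metric.sphere c R, Regular a (m + 1) z) {i j : ℕ} (hi : i ≤ N) (hj : 1 ≤ j) :
    entry a b c R (m + 1) h i j = (1 - a (m + 1) * b j) * entry a b c R m h i j +
      a (m + 1) * b j * entry a b c R (m + 1) (h - 1) i j := by
  have hz' : ∀ z ∈ Metric.sphere c R, Regular a m z := fun z hzs =>
    ⟨(hz z hzs).ne_zero, fun k h1 h2 => (hz z hzs).ne k h1 (by omega)⟩
  have key : divDiff b c R (core a (m + 1) h) i j = divDiff b c R (core a m h) i j +
      a (m + 1) * divDiff b c R (core a (m + 1) (h - 1)) i j := by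
    unfold divDiff
    rw [← contour_const_mul, ← contour_add hR]
    · refine contour_congr hR fun z hzs => ?_
      rw [core_succ (hz z hzs)]
      ring
    · exact (differentiableOn_core hz').continuousOn.mul (hb.continuousOn_div hi _)
    · exact continuousOn_const.mul
        ((differentiableOn_core hz).continuousOn.mul (hb.continuousOn_div hi _))
  unfold entry
  rw [key, coeff_succ, coeff_succ, ← coeff_mul_b (h := h) (hab.b_ne_zero hj)]
  ring

/-- Write the factor z gained by raising the level as 1/b_j + (z - 1/b_j): the second term extends
the Newton product and so belongs to column `j + 1`. -/
lemma entry_sub_entry (hab : Parameters a b) (hR : 0 < R) (hb : NodesInside b N c R)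
    (hz : ∀ z ∈ Metric.sphere c R, Regular a m z) {i j : ℕ} (hi : i ≤ N) (hj : 1 ≤ j) :
    entry a b c R m h i j = entry a b c R m (h - 1) i j +
      coeff a b m h j / coeff a b m (h - 1) (j + 1) * entry a b c R m (h - 1) i (j + 1) := by
  have hbj := hab.b_ne_zero hj
  obtain ⟨j, rfl⟩ := Nat.exists_eq_add_of_le' hj
  have key : divDiff b c R (core a m h) i (j + 1) = (1 / b (j + 1)) *
      divDiff b c R (core a m (h - 1)) i (j + 1) +
        divDiff b c R (core a m (h - 1)) i (j + 1 + 1) := by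
    unfold divDiff
    rw [← contour_const_mul, ← contour_add hR]
    · refine contour_congr hR fun z hzs => ?_
      have : core a m h z = z * core a m (h - 1) z := by
        unfold core
        rw [← mul_div_assoc, mul_comm z, ← zpow_add_one₀ (hz z hzs).ne_zero, sub_add_cancel]
      have e : bProd b (j + 1 + 1 - 1) z = bProd b j z * (z - 1 / (b (j + 1) : ℂ)) :=
        bProd_succ j z
      rw [this, e, Nat.add_sub_cancel]
      ring
    · exact continuousOn_const.mul
        ((differentiableOn_core hz).continuousOn.mul (hb.continuousOn_div hi _))
    · exact (differentiableOn_core hz).continuousOn.mul (hb.continuousOn_div hi _)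
  have hc : coeff a b m (h - 1) (j + 1 + 1) ≠ 0 := coeff_ne_zero hab (by omega)
  unfold entry
  rw [key, ← coeff_mul_b (h := h) hbj]
  field_simp

/-- The poles of `core a m h z * (bProd b (j-1) z / bProd b i z)`, with multiplicity. -/
noncomputable def poles (a b : ℕ → ℝ) (m : ℕ) (h : ℤ) (i : ℕ) : Multiset ℂ :=
  (Finset.Icc 1 i).val.map (fun k => 1 / (b k : ℂ)) + (Finset.Icc 1 m).val.map (fun k => (a k : ℂ)) +
    Multiset.replicate (1 - h - m).toNat 0

/-- The numerator of `core a m h z * (bProd b (j-1) z / bProd b i z)`. -/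
noncomputable def numerator (b : ℕ → ℝ) (m : ℕ) (h : ℤ) (j : ℕ) : Polynomial ℂ :=
  Polynomial.X ^ (h - 1 + m).toNat *
    ∏ k ∈ Finset.Icc 1 (j - 1), (Polynomial.X - Polynomial.C (1 / (b k : ℂ)))

lemma core_mul_eq (hz : z ≠ 0) (i j : ℕ) :
    core a m h z * (bProd b (j - 1) z / bProd b i z) =
      (numerator b m h j).eval z * ((poles a b m h i).map fun p => (z - p)⁻¹).prod := by
  have h1 : ∏ k ∈ Finset.Icc 1 m, (1 - (a k : ℂ) / z) =
      (∏ k ∈ Finset.Icc 1 m, (z - (a k : ℂ))) / z ^ m := by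
    rw [Finset.prod_congr rfl fun k _ => (by field_simp :
      (1 - (a k : ℂ) / z) = (z - a k) / z), Finset.prod_div_distrib]
    simp
  -- At most one of the two truncated exponents is nonzero: together they give z^(h - 1 + m), put in
  -- the numerator or among the poles according to its sign.
  have h2 : z ^ (h - 1) = z ^ (h - 1 + m).toNat * (z⁻¹) ^ (1 - h - m).toNat * (z ^ m)⁻¹ := by
    rw [← zpow_natCast, ← zpow_natCast, ← zpow_natCast, inv_zpow', ← zpow_neg, ← zpow_add₀ hz,
      ← zpow_add₀ hz]
    congr 1
    omega
  simp only [core, numerator, poles, bProd, Multiset.map_add, Multiset.prod_add,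
    Multiset.map_map, Multiset.map_replicate, Multiset.prod_replicate, Function.comp_def,
    Polynomial.eval_mul, Polynomial.eval_pow, Polynomial.eval_X, Polynomial.eval_prod,
    Polynomial.eval_sub, Polynomial.eval_C, sub_zero]
  rw [← Finset.prod_eq_multiset_prod, ← Finset.prod_eq_multiset_prod, Finset.prod_inv_distrib,
    Finset.prod_inv_distrib, h1, h2]
  field_simp

lemma mem_poles {i : ℕ} {p : ℂ} : p ∈ poles a b m h i ↔
    (∃ k, 1 ≤ k ∧ k ≤ i ∧ p = 1 / (b k : ℂ)) ∨ (∃ k, 1 ≤ k ∧ k ≤ m ∧ p = (a k : ℂ)) ∨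
      (h ≤ -(m : ℤ) ∧ p = 0) := by
  have h1 : (1 - h - m).toNat ≠ 0 ↔ h ≤ -(m : ℤ) := by omega
  simp only [poles, Multiset.mem_add, Multiset.mem_map, Finset.mem_val, Finset.mem_Icc,
    Multiset.mem_replicate, h1, or_assoc, and_assoc, eq_comm]

/-- The circle of centre `0` and radius `R` encloses all the possible poles. -/
structure EnclosesAll (a b : ℕ → ℝ) (N : ℕ) (R : ℝ) : Prop where
  pos : 0 < R
  nodes : NodesInside b N 0 R
  inside : ∀ k, 1 ≤ k → (a k : ℂ) ∈ Metric.ball 0 R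

lemma EnclosesAll.regular (hR : EnclosesAll a b N R) (m : ℕ) :
    ∀ z ∈ Metric.sphere (0 : ℂ) R, Regular a m z := fun z hz =>
  ⟨fun h => by
    rw [h, Metric.mem_sphere, dist_self] at hz
    exact hR.pos.ne hz, fun k hk _ h => by
    have := hR.inside k hk
    rw [← h, Metric.mem_ball, Metric.mem_sphere.1 hz] at this
    exact lt_irrefl _ this⟩

lemma EnclosesAll.poles_mem (hR : EnclosesAll a b N R) {i : ℕ} (hi : i ≤ N) {p : ℂ}
    (hp : p ∈ poles a b m h i) : p ∈ Metric.ball (0 : ℂ) R := by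
  rcases mem_poles.1 hp with ⟨k, h1, h2, rfl⟩ | ⟨k, h1, _, rfl⟩ | ⟨_, rfl⟩
  · exact hR.nodes k h1 (h2.trans hi)
  · exact hR.inside k h1
  · exact Metric.mem_ball_self hR.pos

lemma notMem_sphere_of_mem_ball {p : ℂ} (h : p ∈ Metric.ball c R) : p ∉ Metric.sphere c R :=
  fun h' => by
    rw [Metric.mem_ball, Metric.mem_sphere.1 h'] at h
    exact lt_irrefl _ h

lemma notMem_sphere_of_notMem {p : ℂ} (h : p ∉ Metric.closedBall c R) : p ∉ Metric.sphere c R :=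
  fun h' => h (Metric.sphere_subset_closedBall h')

/-- In the first column the integrand behaves like z^(h - 1 - i) at infinity, so it decays at least
like z^(-2), and all its poles are inside. -/
lemma entry_one_eq_zero (hR : EnclosesAll a b N R) (hh : h ≤ 0) {i : ℕ} (hi : 1 ≤ i)
    (hiN : i ≤ N) : entry a b 0 R m h i 1 = 0 := by
  classical
  obtain ⟨ρ, h1, h2⟩ := exists_residues (poles a b m h i).toFinset (poles a b m h i)
    (fun p hp => by simpa using hp) (numerator b m h 1)
  have h3 := h1 0 R hR.pos fun p hp =>
    notMem_sphere_of_mem_ball (hR.poles_mem hiN (by simpa using hp))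
  rw [Finset.sum_congr rfl fun p hp =>
    Set.indicator_of_mem (hR.poles_mem hiN (by simpa using hp)) ρ, h2] at h3
  · unfold entry divDiff
    rw [contour_congr hR.pos fun z hz => core_mul_eq (hR.regular 0 z hz).ne_zero i 1, h3, mul_zero]
  · simp only [numerator, poles, Nat.sub_self, Finset.Icc_eq_empty_of_lt zero_lt_one,
      Finset.prod_empty, mul_one, Polynomial.degree_X_pow, Multiset.card_add, Multiset.card_map,
      Finset.card_val, Nat.card_Icc, Nat.add_sub_cancel, Multiset.card_replicate]
    exact_mod_cast (by omega : (h - 1 + m).toNat < i + m + (1 - h - m).toNat - 1)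

lemma core_zero_natCast (h : ℕ) (z : ℂ) : core a 0 ((h : ℤ) + 1) z = z ^ h := by
  simp [core]

lemma entry_zero_of_lt (hR : EnclosesAll a b N R) (hh : 1 ≤ h) {i j : ℕ} (hij : i < j)
    (hiN : i ≤ N) : entry a b 0 R 0 h i j = 0 := by
  obtain ⟨h, rfl⟩ : ∃ h' : ℕ, h = (h' : ℤ) + 1 := ⟨(h - 1).toNat, by omega⟩
  unfold entry
  rw [divDiff_of_lt hR.pos hR.nodes _ hij hiN, mul_zero]
  simp_rw [funext (core_zero_natCast (a := a) h)]
  fun_prop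

lemma entry_zero_self (hab : Parameters a b) (hR : EnclosesAll a b N R) (hh : 1 ≤ h) {i : ℕ}
    (hi : 1 ≤ i) (hiN : i ≤ N) : entry a b 0 R 0 h i i = 1 := by
  obtain ⟨h, rfl⟩ : ∃ h' : ℕ, h = (h' : ℤ) + 1 := ⟨(h - 1).toNat, by omega⟩
  have hb := hab.b_ne_zero hi
  unfold entry
  rw [divDiff_self hR.pos hR.nodes _ hi hiN]
  · simp [core, coeff, hb]
  · simp_rw [funext (core_zero_natCast (a := a) h)]
    fun_prop

end Entries

/-! ### Recursion and boundary relation for the determinant. -/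

section Determinant

/-- The matrix of the determinantal formula when column `j` has `M j` rows and level `h j`. -/
noncomputable def transMatrix (a b : ℕ → ℝ) (N : ℕ) (R : ℝ) (M : ℕ → ℕ) (h : ℕ → ℤ) :
    Matrix (Fin N) (Fin N) ℂ :=
  Matrix.of fun i j => entry a b 0 R (M (j + 1)) (h (j + 1)) (i + 1) (j + 1)

variable {a b : ℕ → ℝ} {N : ℕ} {R : ℝ} {M : ℕ → ℕ} {h : ℕ → ℤ}

lemma transMatrix_update (l : Fin N) (m' : ℕ) (h' : ℤ) :
    transMatrix a b N R (Function.update M (l + 1) m') (Function.update h (l + 1) h') =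
      (transMatrix a b N R M h).updateCol l
        fun i : Fin N => entry a b 0 R m' h' ((i : ℕ) + 1) (l + 1) := by
  ext i j
  by_cases hj : j = l
  · subst hj
    simp [transMatrix]
  · have : (j : ℕ) + 1 ≠ l + 1 := fun h => hj (Fin.ext (by omega))
    simp [transMatrix, Matrix.updateCol_ne hj, Function.update_of_ne this]

lemma transMatrix_congr {M' : ℕ → ℕ} {h' : ℕ → ℤ} (hM : ∀ i, 1 ≤ i → i ≤ N → M i = M' i)
    (hh : ∀ i, 1 ≤ i → i ≤ N → h i = h' i) :
    transMatrix a b N R M h = transMatrix a b N R M' h' := by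
  ext i j
  simp only [transMatrix, Matrix.of_apply]
  rw [hM _ (by omega) (by omega), hh _ (by omega) (by omega)]

lemma det_transMatrix_succ (hab : Parameters a b) (hR : EnclosesAll a b N R) {l m : ℕ} (hl : l < N)
    (hM : M (l + 1) = m + 1) :
    (transMatrix a b N R M h).det =
      (1 - a (m + 1) * b (l + 1)) *
          (transMatrix a b N R (Function.update M (l + 1) m) h).det +
        a (m + 1) * b (l + 1) *
          (transMatrix a b N R M (Function.update h (l + 1) (h (l + 1) - 1))).det := by
  have e1 := transMatrix_update (N := N) (a := a) (b := b) (R := R) (M := M) (h := h) ⟨l, hl⟩ (m + 1)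
    (h (l + 1))
  have e2 := transMatrix_update (N := N) (a := a) (b := b) (R := R) (M := M) (h := h) ⟨l, hl⟩ m (h (l + 1))
  have e3 := transMatrix_update (N := N) (a := a) (b := b) (R := R) (M := M) (h := h) ⟨l, hl⟩ (m + 1)
    (h (l + 1) - 1)
  simp only [Function.update_eq_self] at e1 e2
  simp only [← hM, Function.update_eq_self] at e1 e3
  rw [e1, e2, e3, ← Matrix.det_updateCol_smul, ← Matrix.det_updateCol_smul,
    ← Matrix.det_updateCol_add]
  congr 2
  funext i
  simp only [Pi.add_apply, Pi.smul_apply, smul_eq_mul, hM]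
  exact entry_succ hab hR.pos hR.nodes (hR.regular _) (by omega) (by omega)

/-- By `entry_sub_entry`, the two versions of column `l + 1` differ by a multiple of column `l + 2`,
which already has the lower level. -/
lemma det_transMatrix_boundary (hab : Parameters a b) (hR : EnclosesAll a b N R) {l : ℕ}
    (hl : l + 1 < N) (hM : M (l + 1) = M (l + 2)) (hh : h (l + 2) = h (l + 1) - 1) :
    (transMatrix a b N R M h).det =
      (transMatrix a b N R M (Function.update h (l + 1) (h (l + 1) - 1))).det := by
  have e1 := transMatrix_update (N := N) (a := a) (b := b) (R := R) (M := M)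
    (h := Function.update h (l + 1) (h (l + 1) - 1)) ⟨l, by omega⟩ (M (l + 1)) (h (l + 1))
  simp only [Function.update_eq_self, Function.update_idem] at e1
  rw [e1]
  have hne : (⟨l, by omega⟩ : Fin N) ≠ ⟨l + 1, hl⟩ := by simp
  rw [← Matrix.det_updateCol_add_smul_self
    (transMatrix a b N R M (Function.update h (l + 1) (h (l + 1) - 1))) hne
    (coeff a b (M (l + 1)) (h (l + 1)) (l + 1) /
      coeff a b (M (l + 1)) (h (l + 1) - 1) (l + 1 + 1))]
  congr 2
  funext i
  have hi : (i : ℕ) + 1 ≤ N := i.2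
  rw [entry_sub_entry hab hR.pos hR.nodes (hR.regular _) hi (by omega)]
  simp [transMatrix, hM, hh]

lemma det_transMatrix_eq_zero (hR : EnclosesAll a b N R) (hN : 1 ≤ N) (hh : h 1 ≤ 0) :
    (transMatrix a b N R M h).det = 0 :=
  Matrix.det_eq_zero_of_column_eq_zero ⟨0, hN⟩ fun i => by
    simp only [transMatrix, Matrix.of_apply, zero_add]
    exact entry_one_eq_zero hR hh (by omega) (by omega)

lemma det_transMatrix_eq_one (hab : Parameters a b) (hR : EnclosesAll a b N R)
    (hM : ∀ i, 1 ≤ i → i ≤ N → M i = 0) (hh : ∀ i, 1 ≤ i → i ≤ N → 1 ≤ h i) :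
    (transMatrix a b N R M h).det = 1 := by
  rw [Matrix.det_of_isLowerTriangular]
  · refine Finset.prod_eq_one fun i _ => ?_
    simp only [transMatrix, Matrix.of_apply]
    rw [hM _ (by omega) (by omega)]
    exact entry_zero_self hab hR (hh _ (by omega) (by omega)) (by omega) (by omega)
  · intro i j hij
    have hij' : i < j := hij
    simp only [transMatrix, Matrix.of_apply]
    rw [hM _ (by omega) (by omega)]
    exact entry_zero_of_lt hR (hh _ (by omega) (by omega)) (by omega) (by omega)

/-- The boundary condition, used repeatedly: lowering the level of column `j + 1` by one may be
replaced by lowering all levels of the columns up to `j + 1` to that value. -/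
lemma det_transMatrix_lower (hab : Parameters a b) (hR : EnclosesAll a b N R) {j : ℕ} (hj : j < N)
    (hM : ∀ i, 1 ≤ i → i ≤ j + 1 → M i = M (j + 1))
    (hh : ∀ i i', 1 ≤ i → i ≤ i' → i' ≤ N → h i ≤ h i') :
    (transMatrix a b N R M (Function.update h (j + 1) (h (j + 1) - 1))).det =
      (transMatrix a b N R M fun i =>
        if i ≤ j + 1 then min (h i) (h (j + 1) - 1) else h i).det := by
  -- The lowering spreads to the left one column at a time; `d` counts the columns before `j + 1`
  -- already treated.
  have key : ∀ d ≤ j, (transMatrix a b N R M (Function.update h (j + 1) (h (j + 1) - 1))).det =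
      (transMatrix a b N R M fun i => if j + 1 - d ≤ i ∧ i ≤ j + 1 then
        min (h i) (h (j + 1) - 1) else h i).det := by
    intro d
    induction d with
    | zero =>
      intro _
      congr 2
      funext i
      by_cases hi : i = j + 1
      · subst hi; simp
      · rw [Function.update_of_ne hi, if_neg (by omega)]
    | succ d ih =>
      intro hd
      rw [ih (by omega)]
      obtain ⟨l, hl⟩ : ∃ l, j = l + d + 1 := ⟨j - d - 1, by omega⟩
      have e1 : j + 1 - d = l + 2 := by omega
      have e2 : j + 1 - (d + 1) = l + 1 := by omega
      rw [e1, e2]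
      have hle := hh (l + 1) (j + 1) (by omega) (by omega) (by omega)
      have hle2 := hh (l + 1) (l + 2) (by omega) (by omega) (by omega)
      have hle3 := hh (l + 2) (j + 1) (by omega) (by omega) (by omega)
      -- Either column `l + 1` is low enough, or monotonicity forces its level and the original
      -- level of column `l + 2` to equal `h (j + 1)`; then column `l + 2` now sits exactly one
      -- below and the boundary relation applies.
      by_cases hlt : h (l + 1) ≤ h (j + 1) - 1
      · congr 2
        funext i
        by_cases hi : i = l + 1
        · subst hi
          rw [if_neg (by omega), if_pos (by omega), min_eq_left hlt]
        · simp only [show (l + 2 ≤ i ∧ i ≤ j + 1) ↔ (l + 1 ≤ i ∧ i ≤ j + 1) by omega]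
      · rw [det_transMatrix_boundary hab hR (l := l) (by omega)]
        · congr 2
          funext i
          by_cases hi : i = l + 1
          · subst hi
            rw [Function.update_self, if_neg (by omega), if_pos (by omega)]
            omega
          · rw [Function.update_of_ne hi]
            simp only [show (l + 2 ≤ i ∧ i ≤ j + 1) ↔ (l + 1 ≤ i ∧ i ≤ j + 1) by omega]
        · rw [hM (l + 1) (by omega) (by omega), hM (l + 2) (by omega) (by omega)]
        · simp only [le_refl, true_and]
          rw [if_pos (by omega), if_neg (by omega)]
          omega
  rw [key j le_rfl]
  congr 1
  refine transMatrix_congr (fun _ _ _ => rfl) fun i hi _ => ?_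
  simp only [show (j + 1 - j ≤ i ∧ i ≤ j + 1) ↔ i ≤ j + 1 by omega]

end Determinant

/-! ### Monotonicity of the growth function. -/

section Growth

variable {w : ℕ → ℕ → ℕ}

lemma growth_zero_right (m : ℕ) : growth 0 w m 0 = 0 := by
  cases m <;> simp [growth]

lemma growth_zero_left (n : ℕ) : growth 0 w 0 n = 0 := by
  cases n <;> simp [growth]

lemma growth_succ (m n : ℕ) : growth 0 w (m + 1) (n + 1) =
    max (growth 0 w m (n + 1)) (growth 0 w (m + 1) n) + (w (m + 1) (n + 1) : ℤ) := by
  rw [growth]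

lemma growth_mono_right (m : ℕ) : Monotone (growth 0 w m) := by
  refine monotone_nat_of_le_succ fun n => ?_
  cases m with
  | zero => simp [growth_zero_left]
  | succ m =>
    rw [growth_succ]
    have := le_max_right (growth 0 w m (n + 1)) (growth 0 w (m + 1) n)
    omega

lemma growth_nonneg (m n : ℕ) : 0 ≤ growth 0 w m n := by
  rw [← growth_zero_right (w := w) m]
  exact growth_mono_right m (Nat.zero_le n)

end Growth

/-! ### The recursion for the probabilities. -/

section Independence

variable {Ω : Type*} {a b : ℕ → ℝ} {W : ℕ → ℕ → Ω → ℕ} {N : ℕ}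

/-- The σ-algebra is arbitrary so that it can be the one generated by all weights but one. -/
lemma measurable_growth {𝓕 : MeasurableSpace Ω} (m n : ℕ)
    (hW : ∀ i j, 1 ≤ i → i ≤ m → 1 ≤ j → j ≤ n → Measurable[𝓕] (W i j)) :
    Measurable[𝓕] fun u => growth 0 (fun i j => W i j u) m n := by
  induction m generalizing n with
  | zero => simp only [growth_zero_left]; exact measurable_const
  | succ m ihm =>
    induction n with
    | zero => simp only [growth_zero_right]; exact measurable_const
    | succ n ihn =>
      simp only [growth_succ]
      have h1 := ihm (n + 1) fun i j h1 h2 h3 h4 => hW i j h1 (by omega) h3 h4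
      have h2 := ihn fun i j h1 h2 h3 h4 => hW i j h1 h2 h3 (by omega)
      have h3 := hW (m + 1) (n + 1) (by omega) le_rfl (by omega) le_rfl
      exact (h1.max h2).add ((measurable_from_top (f := fun k : ℕ => (k : ℤ))).comp h3)

/-- The event that column `i` is below the level `h i` after `M i` rows, for `1 ≤ i ≤ N`. -/
def belowEvent (W : ℕ → ℕ → Ω → ℕ) (N : ℕ) (M : ℕ → ℕ) (h : ℕ → ℤ) : Set Ω :=
  {u | ∀ i, 1 ≤ i → i ≤ N → growth 0 (fun i j => W i j u) (M i) i < h i}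

/-- The rows of the columns once the first `j` cells of row `m + 1` have been added. -/
def profile (m j : ℕ) (i : ℕ) : ℕ := if i ≤ j then m + 1 else m

lemma belowEvent_congr {M M' : ℕ → ℕ} {h h' : ℕ → ℤ} (hM : ∀ i, 1 ≤ i → i ≤ N → M i = M' i)
    (hh : ∀ i, 1 ≤ i → i ≤ N → h i = h' i) : belowEvent W N M h = belowEvent W N M' h' := by
  ext u
  simp only [belowEvent, Set.mem_ofPred_eq]
  refine forall_congr' fun i => forall_congr' fun hi => forall_congr' fun hiN => ?_
  rw [hM i hi hiN, hh i hi hiN]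

lemma belowEvent_eq_empty {M : ℕ → ℕ} {h : ℕ → ℤ} (hN : 1 ≤ N) (hh : h 1 ≤ 0) :
    belowEvent W N M h = ∅ := by
  refine Set.eq_empty_of_forall_notMem fun u hu => ?_
  have h1 := hu 1 le_rfl hN
  have h2 := growth_nonneg (w := fun i j => W i j u) (M 1) 1
  omega

/-- The columns up to `j + 1` all end in the same row, along which the growth function is
nondecreasing: the bound at `j + 1` holds to its left. It is the counterpart of
`det_transMatrix_lower`. -/
lemma belowEvent_lower {m j : ℕ} (hj : j < N) (h : ℕ → ℤ) :
    belowEvent W N (profile m (j + 1)) (Function.update h (j + 1) (h (j + 1) - 1)) =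
      belowEvent W N (profile m (j + 1))
        fun i => if i ≤ j + 1 then min (h i) (h (j + 1) - 1) else h i := by
  ext u
  simp only [belowEvent, Set.mem_ofPred_eq]
  constructor
  · intro H i hi hiN
    have h1 := H i hi hiN
    split_ifs with hij
    · have h2 := H (j + 1) (by omega) (by omega)
      rw [Function.update_self] at h2
      have h3 : profile m (j + 1) i = profile m (j + 1) (j + 1) := by simp [profile, hij]
      have h4 := growth_mono_right (w := fun i j => W i j u) (profile m (j + 1) (j + 1)) hij
      rw [h3] at h1 ⊢
      refine lt_min ?_ (h4.trans_lt h2)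
      by_cases hij' : i = j + 1
      · subst hij'; omega
      · rwa [Function.update_of_ne hij'] at h1
    · rwa [Function.update_of_ne (by omega)] at h1
  · intro H i hi hiN
    have h1 := H i hi hiN
    by_cases hij : i = j + 1
    · subst hij
      rw [Function.update_self]
      simp only [le_refl, if_true] at h1
      exact h1.trans_le (min_le_right _ _)
    · rw [Function.update_of_ne hij]
      split_ifs at h1
      · exact h1.trans_le (min_le_left _ _)
      · exact h1

variable {mΩ : MeasurableSpace Ω} {μ : Measure Ω}

/-- The law of the sum of a nonnegative variable and of an independent geometric one. -/
lemma measureReal_inter_add_lt [IsProbabilityMeasure μ] {𝓕 : MeasurableSpace Ω} (h𝓕 : 𝓕 ≤ mΩ) {w : Ω → ℕ}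
    (hw : Measurable[mΩ] w) {q : ℝ} (hq : q ∈ Set.Ioo (0 : ℝ) 1)
    (hlaw : ∀ k : ℕ, μ {u | w u = k} = ENNReal.ofReal ((1 - q) * q ^ k))
    (hind : Indep 𝓕 (MeasurableSpace.comap w ⊤) μ) {A : Set Ω} (hA : MeasurableSet[𝓕] A)
    {X : Ω → ℤ} (hX : Measurable[𝓕] X) (hX0 : ∀ u, 0 ≤ X u) {t : ℤ} {K : ℕ} (hK : t ≤ K) :
    μ.real (A ∩ {u | X u + w u < t}) =
      ∑ k ∈ Finset.range K, (1 - q) * q ^ k * μ.real (A ∩ {u | X u < t - k}) := by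
  have hmeas : ∀ k : ℕ, MeasurableSet[𝓕] (A ∩ {u | X u < t - k}) := fun k =>
    hA.inter (hX (measurableSet_Iio (a := t - (k : ℤ))))
  have hset : A ∩ {u | X u + w u < t} =
      ⋃ k ∈ Finset.range K, (A ∩ {u | X u < t - k}) ∩ {u | w u = k} := by
    ext u
    simp only [Set.mem_inter_iff, Set.mem_ofPred_eq, Set.mem_iUnion, Finset.mem_range, exists_prop]
    constructor
    · rintro ⟨h1, h2⟩
      exact ⟨w u, by have := hX0 u; omega, ⟨h1, by omega⟩, rfl⟩
    · rintro ⟨k, _, ⟨h1, h2⟩, rfl⟩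
      exact ⟨h1, by omega⟩
  rw [hset, measureReal_biUnion_finset]
  · refine Finset.sum_congr rfl fun k _ => ?_
    have h1 := (Indep_iff 𝓕 (MeasurableSpace.comap w ⊤) μ).1 hind _ {u | w u = k} (hmeas k)
      ⟨{k}, trivial, rfl⟩
    rw [measureReal_def, h1, hlaw, ENNReal.toReal_mul, ENNReal.toReal_ofReal, mul_comm]
    · rfl
    · have := hq.1; have := hq.2
      have : 0 ≤ 1 - q := by linarith
      positivity
  · intro k _ l _ hkl
    refine Set.disjoint_left.2 fun u hu hu' => hkl ?_
    rw [← hu.2, ← hu'.2]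
  · exact fun k _ => (h𝓕 _ (hmeas k)).inter
      (hw (measurableSet_singleton k : MeasurableSet ({k} : Set ℕ)))

/-- The memoryless property of the geometric law. -/
lemma measureReal_inter_add_lt_succ [IsProbabilityMeasure μ] {𝓕 : MeasurableSpace Ω} (h𝓕 : 𝓕 ≤ mΩ) {w : Ω → ℕ}
    (hw : Measurable[mΩ] w) {q : ℝ} (hq : q ∈ Set.Ioo (0 : ℝ) 1)
    (hlaw : ∀ k : ℕ, μ {u | w u = k} = ENNReal.ofReal ((1 - q) * q ^ k))
    (hind : Indep 𝓕 (MeasurableSpace.comap w ⊤) μ) {A : Set Ω} (hA : MeasurableSet[𝓕] A)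
    {X : Ω → ℤ} (hX : Measurable[𝓕] X) (hX0 : ∀ u, 0 ≤ X u) (t : ℤ) :
    μ.real (A ∩ {u | X u + w u < t}) = (1 - q) * μ.real (A ∩ {u | X u < t}) +
      q * μ.real (A ∩ {u | X u + w u < t - 1}) := by
  -- Any cutoff beyond the level works, as `X ≥ 0`. These two make the sum for `t` equal to its `k =
  -- 0` term plus `q` times the sum for `t - 1`.
  rw [measureReal_inter_add_lt h𝓕 hw hq hlaw hind hA hX hX0 (K := t.toNat + 1) (by omega),
    measureReal_inter_add_lt h𝓕 hw hq hlaw hind hA hX hX0 (K := t.toNat) (by omega),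
    Finset.sum_range_succ', Finset.mul_sum, add_comm]
  congr 1
  · simp
  · refine Finset.sum_congr rfl fun k _ => ?_
    rw [show t - ((k + 1 : ℕ) : ℤ) = t - 1 - k by push_cast; ring]
    ring

/-- The σ-algebra is the one generated by the weights of all the other cells. -/
lemma GeometricEnvironment.indep_cell (hW : GeometricEnvironment μ a b W) {i j : ℕ} (hi : 1 ≤ i)
    (hj : 1 ≤ j) : ∃ 𝓕 ≤ mΩ, Indep 𝓕 (MeasurableSpace.comap (W i j) ⊤) μ ∧
      ∀ i' j', 1 ≤ i' → 1 ≤ j' → (i', j') ≠ (i, j) → Measurable[𝓕] (W i' j') := by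
  let m : ℕ+ × ℕ+ → MeasurableSpace Ω := fun q =>
    MeasurableSpace.comap (W (q.1 : ℕ) (q.2 : ℕ)) ⊤
  let q₀ : ℕ+ × ℕ+ := (⟨i, hi⟩, ⟨j, hj⟩)
  have hm : ∀ q, m q ≤ mΩ := fun q => (hW.measurable _ _ q.1.2 q.2.2).comap_le
  have hind : iIndep m μ := (iIndepFun_iff_iIndep _ _ _).1 hW.indep
  refine ⟨⨆ q ∈ ({q₀}ᶜ : Set (ℕ+ × ℕ+)), m q, iSup₂_le fun q _ => hm q, ?_, ?_⟩
  · have := indep_iSup_of_disjoint hm hind (S := {q₀}ᶜ) (T := {q₀}) disjoint_compl_left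
    rw [iSup_singleton] at this
    exact this
  · intro i' j' hi' hj' hne
    refine Measurable.mono (comap_measurable (W i' j')) (le_iSup₂_of_le
      (⟨i', hi'⟩, ⟨j', hj'⟩) ?_ le_rfl) le_rfl
    intro h
    apply hne
    have h : ((⟨i', hi'⟩, ⟨j', hj'⟩) : ℕ+ × ℕ+) = (⟨i, hi⟩, ⟨j, hj⟩) := Set.mem_singleton_iff.1 h
    exact Prod.ext (congrArg (fun q => (q.1 : ℕ)) h) (congrArg (fun q => (q.2 : ℕ)) h)

lemma measureReal_belowEvent_succ [IsProbabilityMeasure μ] (hab : Parameters a b) (hW : GeometricEnvironment μ a b W)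
    {m j : ℕ} (hj : j < N) {h : ℕ → ℤ} (hh : ∀ i i', 1 ≤ i → i ≤ i' → i' ≤ N → h i ≤ h i')
    (h1 : 1 ≤ h 1) :
    μ.real (belowEvent W N (profile m (j + 1)) h) =
      (1 - a (m + 1) * b (j + 1)) * μ.real (belowEvent W N (profile m j) h) +
        a (m + 1) * b (j + 1) * μ.real (belowEvent W N (profile m (j + 1))
          (Function.update h (j + 1) (h (j + 1) - 1))) := by
  have hwm := hW.measurable (m + 1) (j + 1) (by omega) (by omega)
  have hlaw := hW.law (m + 1) (j + 1) (by omega) (by omega)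
  obtain ⟨𝓕, h𝓕, hind, hmeas⟩ := hW.indep_cell (i := m + 1) (j := j + 1) (by omega) (by omega)
  -- `A` collects the constraints on the other columns and `X` is the value at the new cell before
  -- its weight is added; neither involves that weight.
  let A : Set Ω := {u | ∀ i, 1 ≤ i → i ≤ N → i ≠ j + 1 →
    growth 0 (fun i j => W i j u) (profile m j i) i < h i}
  let X : Ω → ℤ := fun u => max (growth 0 (fun i j => W i j u) m (j + 1))
    (growth 0 (fun i j => W i j u) (m + 1) j)
  have hA : MeasurableSet[𝓕] A := by
    simp only [A, Set.ofPred_forall]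
    refine MeasurableSet.iInter fun i => MeasurableSet.iInter fun hi => MeasurableSet.iInter
      fun hiN => MeasurableSet.iInter fun hij => ?_
    refine measurable_growth (profile m j i) i (fun i' j' h1 h2 h3 h4 => hmeas i' j' h1 h3 ?_)
      (measurableSet_Iio (a := h i))
    intro he
    rw [Prod.mk.injEq] at he
    unfold profile at h2
    split_ifs at h2 <;> omega
  have hX : Measurable[𝓕] X := by
    refine Measurable.max (measurable_growth _ _ fun i' j' h1 h2 h3 h4 => hmeas i' j' h1 h3 ?_)
      (measurable_growth _ _ fun i' j' h1 h2 h3 h4 => hmeas i' j' h1 h3 ?_) <;>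
    · intro he
      rw [Prod.mk.injEq] at he
      omega
  have hX0 : ∀ u, 0 ≤ X u := fun u => le_max_of_le_left (growth_nonneg _ _)
  have hset : ∀ t : ℤ, belowEvent W N (profile m (j + 1)) (Function.update h (j + 1) t) =
      A ∩ {u | X u + W (m + 1) (j + 1) u < t} := by
    intro t
    ext u
    simp only [belowEvent, A, X, Set.mem_ofPred_eq, Set.mem_inter_iff]
    constructor
    · intro H
      refine ⟨fun i hi hiN hij => ?_, ?_⟩
      · have := H i hi hiN
        rw [Function.update_of_ne hij] at this
        rwa [show profile m j i = profile m (j + 1) i by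
          unfold profile; split_ifs <;> omega]
      · have := H (j + 1) (by omega) (by omega)
        rwa [Function.update_self, show profile m (j + 1) (j + 1) = m + 1 by simp [profile],
          growth_succ] at this
    · rintro ⟨H1, H2⟩ i hi hiN
      by_cases hij : i = j + 1
      · subst hij
        rwa [Function.update_self, show profile m (j + 1) (j + 1) = m + 1 by simp [profile],
          growth_succ]
      · rw [Function.update_of_ne hij, show profile m (j + 1) i = profile m j i by
          unfold profile; split_ifs <;> omega]
        exact H1 i hi hiN hij
  -- `X` also involves the left neighbour in row `m + 1`. Its bound is free: from column `j`, since
  -- the levels are nondecreasing, or from `1 ≤ h 1` when `j = 0`.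
  have hset' : belowEvent W N (profile m j) h = A ∩ {u | X u < h (j + 1)} := by
    ext u
    simp only [belowEvent, A, X, Set.mem_ofPred_eq, Set.mem_inter_iff, max_lt_iff]
    have hp : profile m j (j + 1) = m := by simp [profile]
    constructor
    · intro H
      refine ⟨fun i hi hiN _ => H i hi hiN, by simpa [hp] using H (j + 1) (by omega) (by omega), ?_⟩
      rcases Nat.eq_zero_or_pos j with rfl | hj0
      · rw [growth_zero_right, zero_add]; omega
      · have := H j hj0 (by omega)
        rw [show profile m j j = m + 1 by simp [profile]] at this
        exact this.trans_le (hh j (j + 1) hj0 (by omega) (by omega))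
    · rintro ⟨H1, H2, _⟩ i hi hiN
      by_cases hij : i = j + 1
      · subst hij; rwa [hp]
      · exact H1 i hi hiN hij
  have e := hset (h (j + 1))
  rw [Function.update_eq_self] at e
  rw [e, hset, hset']
  exact measureReal_inter_add_lt_succ h𝓕 hwm
    (hab.mul_mem _ _ (by omega) (by omega)) hlaw hind hA hX hX0 _

/-- Induction on the level of the new column, which the recursion lowers by one; once it is `≤ 0`,
so is `h 1`, and both sides vanish. -/
lemma belowEvent_profile_succ [IsProbabilityMeasure μ] (hab : Parameters a b) (hW : GeometricEnvironment μ a b W) {R : ℝ}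
    (hR : EnclosesAll a b N R) {m j : ℕ} (hj : j < N)
    (ih : ∀ h : ℕ → ℤ, (∀ i i', 1 ≤ i → i ≤ i' → i' ≤ N → h i ≤ h i') →
      ((μ.real (belowEvent W N (profile m j) h) : ℝ) : ℂ) =
        (transMatrix a b N R (profile m j) h).det) (k : ℕ) :
    ∀ h : ℕ → ℤ, (∀ i i', 1 ≤ i → i ≤ i' → i' ≤ N → h i ≤ h i') → (h (j + 1)).toNat = k →
      ((μ.real (belowEvent W N (profile m (j + 1)) h) : ℝ) : ℂ) =
        (transMatrix a b N R (profile m (j + 1)) h).det := by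
  induction k with
  | zero =>
    intro h hh hk
    have h1 : h 1 ≤ 0 := (hh 1 (j + 1) le_rfl (by omega) (by omega)).trans (by omega)
    rw [belowEvent_eq_empty (by omega) h1, det_transMatrix_eq_zero hR (by omega) h1]
    simp
  | succ k ihk =>
    intro h hh hk
    rcases le_or_gt (h 1) 0 with h1 | h1
    · rw [belowEvent_eq_empty (by omega) h1, det_transMatrix_eq_zero hR (by omega) h1]
      simp
    have hp : profile m (j + 1) (j + 1) = m + 1 := by simp [profile]
    have hu : Function.update (profile m (j + 1)) (j + 1) m = profile m j := by
      funext i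
      by_cases hij : i = j + 1
      · subst hij; simp [profile]
      · rw [Function.update_of_ne hij]
        unfold profile; split_ifs <;> omega
    rw [measureReal_belowEvent_succ hab hW hj hh h1, det_transMatrix_succ hab hR hj hp, hu,
      belowEvent_lower hj, det_transMatrix_lower hab hR hj _ hh, ← ih h hh, ← ihk]
    · push_cast; ring
    · intro i i' hi hii' hi'
      have h2 := hh i i' hi hii' hi'
      split_ifs with h3 h4 h4
      · exact min_le_min_right _ h2
      · exact (min_le_left _ _).trans h2
      · omega
      · exact h2
    · simp only [le_refl, if_true]
      omega
    · intro i hi hij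
      simp [profile, hij]

/-- The determinantal formula for the joint distribution function of a row. -/
theorem measureReal_belowEvent [IsProbabilityMeasure μ] (hab : Parameters a b) (hW : GeometricEnvironment μ a b W) {R : ℝ}
    (hR : EnclosesAll a b N R) (m : ℕ) {h : ℕ → ℤ}
    (hh : ∀ i i', 1 ≤ i → i ≤ i' → i' ≤ N → h i ≤ h i') :
    ((μ.real (belowEvent W N (fun _ => m) h) : ℝ) : ℂ) =
      (transMatrix a b N R (fun _ => m) h).det := by
  induction m generalizing h with
  | zero =>
    rcases Nat.eq_zero_or_pos N with rfl | hN
    · have : belowEvent W 0 (fun _ => 0) h = Set.univ :=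
        Set.eq_univ_of_forall fun u i h1 h2 => by omega
      rw [this]
      simp
    rcases le_or_gt (h 1) 0 with h1 | h1
    · rw [belowEvent_eq_empty hN h1, det_transMatrix_eq_zero hR hN h1]
      simp
    have hpos : ∀ i, 1 ≤ i → i ≤ N → 1 ≤ h i := fun i hi hiN => by
      have := hh 1 i le_rfl hi hiN
      omega
    have : belowEvent W N (fun _ => 0) h = Set.univ :=
      Set.eq_univ_of_forall fun u i hi hiN => by
        have := hpos i hi hiN
        rw [growth_zero_left]
        omega
    rw [this, det_transMatrix_eq_one hab hR (fun _ _ _ => rfl) hpos]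
    simp
  | succ m ih =>
    -- Row `m + 1` is filled cell by cell.
    have key : ∀ j ≤ N, ∀ h : ℕ → ℤ, (∀ i i', 1 ≤ i → i ≤ i' → i' ≤ N → h i ≤ h i') →
        ((μ.real (belowEvent W N (profile m j) h) : ℝ) : ℂ) =
          (transMatrix a b N R (profile m j) h).det := by
      intro j
      induction j with
      | zero =>
        intro _ h hh
        have hp : ∀ i, 1 ≤ i → i ≤ N → profile m 0 i = (fun _ => m) i := fun i hi _ => by
          simp only [profile]; rw [if_neg (by omega)]
        rw [belowEvent_congr hp fun _ _ _ => rfl, transMatrix_congr hp fun _ _ _ => rfl]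
        exact ih hh
      | succ j ihj =>
        intro hj h hh
        exact belowEvent_profile_succ hab hW hR hj (ihj (by omega)) _ h hh rfl
    have hp : ∀ i, 1 ≤ i → i ≤ N → (fun _ => m + 1) i = profile m N i := fun i _ hi => by
      simp [profile, hi]
    rw [belowEvent_congr hp fun _ _ _ => rfl, transMatrix_congr hp fun _ _ _ => rfl]
    exact key N le_rfl h hh

end Independence

/-! ### Products of divided differences over two disjoint circles. -/

section DoubleContour

lemma contour_comm {c c' : ℂ} {R R' : ℝ} (hR : 0 < R) (hR' : 0 < R') {F : ℂ → ℂ → ℂ}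
    (hF : ContinuousOn (Function.uncurry F) (Metric.sphere c R ×ˢ Metric.sphere c' R')) :
    (contour c R fun ζ => contour c' R' fun z => F ζ z) =
      contour c' R' fun z => contour c R fun ζ => F ζ z := by
  have hcont : Continuous fun q : ℝ × ℝ => F (circleMap c R q.1) (circleMap c' R' q.2) :=
    hF.comp_continuous (f := fun q : ℝ × ℝ => (circleMap c R q.1, circleMap c' R' q.2))
      (by fun_prop) fun q => ⟨circleMap_mem_sphere c hR.le _, circleMap_mem_sphere c' hR'.le _⟩
  have hint := intervalIntegral_intervalIntegral_swap (a := 0) (b := 2 * Real.pi) (c := 0)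
    (d := 2 * Real.pi) (F := fun θ φ => deriv (circleMap c R) θ * (deriv (circleMap c' R') φ *
      F (circleMap c R θ) (circleMap c' R' φ))) (by
    simp only [deriv_circleMap]
    refine (Continuous.continuousOn ?_).integrableOn_compact
      (isCompact_uIcc.prod isCompact_uIcc) |>.mono_set
        (Set.prod_mono Set.uIoc_subset_uIcc Set.uIoc_subset_uIcc)
    simp only [Function.uncurry_def]
    exact Continuous.mul (by fun_prop) (Continuous.mul (by fun_prop) hcont))
  simp only [contour, circleIntegral, smul_eq_mul, intervalIntegral.integral_const_mul] at hint ⊢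
  simp only [mul_left_comm _ ((2 * (Real.pi : ℂ) * Complex.I)⁻¹),
    intervalIntegral.integral_const_mul]
  rw [hint]
  congr 3
  funext φ
  rw [← intervalIntegral.integral_const_mul]
  exact intervalIntegral.integral_congr fun θ _ => by ring

lemma continuousOn_contour {c c' : ℂ} {R R' : ℝ} (hR' : 0 < R') {F : ℂ → ℂ → ℂ}
    (hF : ContinuousOn (Function.uncurry F) (Metric.sphere c R ×ˢ Metric.sphere c' R')) :
    ContinuousOn (fun ζ => contour c' R' fun z => F ζ z) (Metric.sphere c R) := by
  rw [continuousOn_iff_continuous_domRestrict]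
  simp only [contour, circleIntegral, smul_eq_mul, deriv_circleMap]
  refine continuous_const.mul (intervalIntegral.continuous_parametric_intervalIntegral_of_continuous'
    (f := fun (ζ : Metric.sphere c R) φ =>
      circleMap 0 R' φ * Complex.I * F ζ (circleMap c' R' φ)) ?_ _ _)
  have : Continuous fun q : Metric.sphere c R × ℝ => F q.1 (circleMap c' R' q.2) :=
    hF.comp_continuous (f := fun q : Metric.sphere c R × ℝ => ((q.1 : ℂ), circleMap c' R' q.2))
      (by fun_prop) fun q => ⟨q.1.2, circleMap_mem_sphere c' hR'.le _⟩
  simp only [Function.uncurry_def]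
  exact Continuous.mul (by fun_prop) this

variable {b : ℕ → ℝ} {N : ℕ}

/-- Newton expansion of the Cauchy kernel: iterate 1/(z - ζ) = 1/(z - w) + (ζ - w)/(z - w) · 1/(z -
ζ) over the nodes w. -/
lemma inv_sub_eq_sum_bProd {z ζ : ℂ} (hz : ∀ k, 1 ≤ k → k ≤ N → z ≠ 1 / (b k : ℂ)) (hzζ : z ≠ ζ) :
    1 / (z - ζ) = ∑ k ∈ Finset.Icc 1 N, bProd b (k - 1) ζ / bProd b k z +
      bProd b N ζ / bProd b N z * (1 / (z - ζ)) := by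
  induction N with
  | zero => simp [bProd_zero]
  | succ N ih =>
    rw [Finset.sum_Icc_succ_top (by omega), add_assoc]
    refine (ih fun k h1 h2 => hz k h1 (by omega)).trans ?_
    congr 1
    have h1 : bProd b N z ≠ 0 := bProd_ne_zero fun k h1 h2 => hz k h1 (by omega)
    have h2 : z - 1 / (b (N + 1) : ℂ) ≠ 0 := sub_ne_zero.2 (hz (N + 1) (by omega) le_rfl)
    have h3 : z - ζ ≠ 0 := sub_ne_zero.2 hzζ
    simp only [bProd_succ, Nat.add_sub_cancel]
    generalize 1 / (b (N + 1) : ℂ) = w at *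
    field_simp
    ring

/-- Summation over the intermediate index of two divided differences taken on disjoint circles. -/
lemma sum_divDiff_mul_divDiff_of_disjoint {cb ca : ℂ} {Rb Ra : ℝ} (hRb : 0 < Rb) (hRa : 0 < Ra)
    (hb : NodesInside b N cb Rb)
    (ha : ∀ z ∈ Metric.sphere ca Ra, ∀ k, 1 ≤ k → k ≤ N → z ≠ 1 / (b k : ℂ))
    (hdisj : Disjoint (Metric.closedBall ca Ra) (Metric.closedBall cb Rb)) {f g : ℂ → ℂ}
    (hf : DifferentiableOn ℂ f (Metric.closedBall cb Rb))
    (hg : ContinuousOn g (Metric.sphere ca Ra)) {i : ℕ} (hi : i ≤ N) (j : ℕ) :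
    ∑ k ∈ Finset.Icc 1 N, divDiff b cb Rb f i k * divDiff b ca Ra g k j =
      contour cb Rb fun ζ => contour ca Ra fun z =>
        f ζ * g z * (bProd b (j - 1) z / bProd b i ζ) * (1 / (z - ζ)) := by
  have hfs := hf.continuousOn.mono Metric.sphere_subset_closedBall
  have hne : ∀ z ∈ Metric.sphere ca Ra, ∀ ζ ∈ Metric.closedBall cb Rb, z - ζ ≠ 0 :=
    fun z hz ζ hζ h => Set.disjoint_left.1 hdisj (Metric.sphere_subset_closedBall hz)
      (sub_eq_zero.1 h ▸ hζ)
  have hquot : ∀ k l, k ≤ N → ContinuousOn (fun z => bProd b l z / bProd b k z)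
      (Metric.sphere ca Ra) := fun k l hk =>
    (differentiable_bProd l).continuous.continuousOn.div
      (differentiable_bProd k).continuous.continuousOn fun z hz =>
        bProd_ne_zero fun k' h1 h2 => ha z hz k' h1 (h2.trans hk)
  have hG : ∀ k ∈ Finset.Icc 1 N, ContinuousOn
      (fun z => g z * (bProd b (j - 1) z / bProd b k z)) (Metric.sphere ca Ra) := fun k hk =>
    hg.mul (hquot k _ (Finset.mem_Icc.1 hk).2)
  have hinner : ∀ ζ ∈ Metric.sphere cb Rb, (contour ca Ra fun z =>
      f ζ * g z * (bProd b (j - 1) z / bProd b i ζ) * (1 / (z - ζ))) =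
      ∑ k ∈ Finset.Icc 1 N, f ζ * (bProd b (k - 1) ζ / bProd b i ζ) * divDiff b ca Ra g k j +
        contour ca Ra fun z => f ζ * (bProd b N ζ / bProd b i ζ) *
          (g z * (bProd b (j - 1) z / bProd b N z)) * (1 / (z - ζ)) := by
    intro ζ hζ
    simp only [divDiff, ← contour_const_mul]
    rw [← contour_sum hRa, ← contour_add hRa]
    · refine contour_congr hRa fun z hz => ?_
      have h1 : z ≠ ζ := sub_ne_zero.1 (hne z hz ζ (Metric.sphere_subset_closedBall hζ))
      nth_rw 1 [inv_sub_eq_sum_bProd (ha z hz) h1, mul_add, Finset.mul_sum]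
      congr 1
      · exact Finset.sum_congr rfl fun k _ => by ring
      · ring
    · exact continuousOn_finsetSum _ fun k hk => continuousOn_const.mul (hG k hk)
    · exact (continuousOn_const.mul (hg.mul (hquot N _ le_rfl))).mul
        (continuousOn_const.div (by fun_prop) fun z hz =>
          hne z hz ζ (Metric.sphere_subset_closedBall hζ))
    · exact fun k hk => continuousOn_const.mul (hG k hk)
  have hrest : ContinuousOn (Function.uncurry fun ζ z => f ζ * (bProd b N ζ / bProd b i ζ) *
      (g z * (bProd b (j - 1) z / bProd b N z)) * (1 / (z - ζ)))
      (Metric.sphere cb Rb ×ˢ Metric.sphere ca Ra) := by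
    simp only [Function.uncurry_def]
    refine ContinuousOn.mul (ContinuousOn.mul ?_ ?_) (continuousOn_const.div (by fun_prop)
      fun q hq => hne q.2 hq.2 q.1 (Metric.sphere_subset_closedBall hq.1))
    · exact (hfs.mul (hb.continuousOn_div hi N)).comp continuousOn_fst fun q hq => hq.1
    · exact (hg.mul (hquot N (j - 1) le_rfl)).comp continuousOn_snd fun q hq => hq.2
  -- The remainder drops out on integrating in ζ first: the N-fold product cancels the denominator,
  -- and z lies outside the disc of ζ.
  have hzero : (contour cb Rb fun ζ => contour ca Ra fun z => f ζ * (bProd b N ζ / bProd b i ζ) *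
      (g z * (bProd b (j - 1) z / bProd b N z)) * (1 / (z - ζ))) = 0 := by
    rw [contour_comm hRb hRa hrest, contour_congr (g := fun _ => 0) hRa, contour_zero]
    intro z hz
    simp only
    rw [contour_congr (g := fun ζ => f ζ * (∏ l ∈ Finset.Ioc i N, (ζ - 1 / (b l : ℂ))) *
      (g z * (bProd b (j - 1) z / bProd b N z)) * (1 / (z - ζ))) hRb]
    · refine contour_eq_zero hRb (((hf.mul (by fun_prop)).mul (by fun_prop)).mul ?_)
      exact (differentiableOn_const _).div (by fun_prop) fun ζ hζ => hne z hz ζ hζ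
    · intro ζ hζ
      have h1 := hb.bProd_ne_zero hi hζ
      simp only
      rw [← bProd_mul_prod_Ioc hi ζ, mul_div_cancel_left₀ _ h1]
  rw [contour_congr hRb hinner, contour_add hRb, hzero, add_zero, contour_sum hRb]
  · exact Finset.sum_congr rfl fun k _ => (contour_mul_const _ _).symm
  · exact fun k _ => (hfs.mul (hb.continuousOn_div hi _)).mul continuousOn_const
  · exact continuousOn_finsetSum _ fun k _ =>
      (hfs.mul (hb.continuousOn_div hi _)).mul continuousOn_const
  · exact continuousOn_contour hRa hrest

end DoubleContour

/-! ### Blocks of indices and their levels. -/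

section Blocks

variable {p N : ℕ} {n : Fin (p + 1) → ℕ} {h : Fin p → ℤ}

lemma exists_mem_block (hn0 : n 0 = 0) (hnN : n (Fin.last p) = N) {j : ℕ} (hj : 1 ≤ j)
    (hjN : j ≤ N) : ∃ r, j ∈ block n r := by
  have key : ∀ k : Fin (p + 1), j ≤ n k → ∃ r, j ∈ block n r := by
    intro k
    induction k using Fin.induction with
    | zero => intro h; omega
    | succ r ih =>
      intro hr
      by_cases hlt : j ≤ n r.castSucc
      · exact ih hlt
      · exact ⟨r, not_le.1 hlt, hr⟩
  exact key (Fin.last p) (by omega)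

lemma lt_of_mem_block (hn : StrictMono n) {r s : Fin p} (hrs : r < s) {i j : ℕ}
    (hi : i ∈ block n r) (hj : j ∈ block n s) : i < j :=
  (hi.2.trans (hn.monotone (Fin.succ_le_castSucc_iff.2 hrs))).trans_lt hj.1

lemma block_unique (hn : StrictMono n) {r s : Fin p} {i : ℕ} (hr : i ∈ block n r)
    (hs : i ∈ block n s) : r = s := by
  rcases lt_trichotomy r s with h | h | h
  · exact absurd (lt_of_mem_block hn h hr hs) (lt_irrefl _)
  · exact h
  · exact absurd (lt_of_mem_block hn h hs hr) (lt_irrefl _)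

lemma level_eq (hn : StrictMono n) {r : Fin p} {j : ℕ} (hj : j ∈ block n r) :
    level n h j = h r := by
  classical
  unfold level
  rw [Finset.sum_eq_single r, if_pos hj]
  · exact fun s _ hs => if_neg fun hjs => hs (block_unique hn hjs hj)
  · exact fun hr => absurd (Finset.mem_univ r) hr

lemma level_mono (hn : StrictMono n) (hn0 : n 0 = 0) (hnN : n (Fin.last p) = N) (hh : Monotone h) :
    ∀ i i', 1 ≤ i → i ≤ i' → i' ≤ N → level n h i ≤ level n h i' := by
  intro i i' hi hii' hi'
  obtain ⟨r, hr⟩ := exists_mem_block hn0 hnN hi (hii'.trans hi')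
  obtain ⟨s, hs⟩ := exists_mem_block hn0 hnN (hi.trans hii') hi'
  rw [level_eq hn hr, level_eq hn hs]
  refine hh (not_lt.1 fun hlt => ?_)
  have := lt_of_mem_block hn hlt hs hr
  omega

/-- By monotonicity along the row, the constraint at the right end of a block implies the same
constraint throughout the block. -/
lemma setOf_growth_lt_eq {Ω : Type*} {W : ℕ → ℕ → Ω → ℕ} (hn : StrictMono n) (hn0 : n 0 = 0)
    (hnN : n (Fin.last p) = N) (m : ℕ) :
    {u | ∀ k : Fin p, growth 0 (fun i j => W i j u) m (n k.succ) < h k} =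
      belowEvent W N (fun _ => m) (level n h) := by
  ext u
  constructor
  · intro H i hi hiN
    obtain ⟨r, hr⟩ := exists_mem_block hn0 hnN hi hiN
    rw [level_eq hn hr]
    exact (growth_mono_right m hr.2).trans_lt (H r)
  · intro H k
    have hlt := hn (Fin.castSucc_lt_succ (i := k))
    have hk : n k.succ ∈ block n k := ⟨hlt, le_rfl⟩
    have := H (n k.succ) (by omega) (hnN ▸ hn.monotone (Fin.le_last _))
    rwa [level_eq hn hk] at this

lemma sum_sum_eq_of_unique {p : ℕ} {G : Fin p → Fin p → ℂ} (r₀ s₀ : Fin p)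
    (hG : ∀ r s, ¬(r = r₀ ∧ s = s₀) → G r s = 0) : ∑ r, ∑ s, G r s = G r₀ s₀ := by
  rw [Finset.sum_eq_single r₀ (fun r _ hr => Finset.sum_eq_zero fun s _ => hG r s fun h => hr h.1)
    (fun h => absurd (Finset.mem_univ _) h)]
  exact Finset.sum_eq_single s₀ (fun s _ hs => hG r₀ s fun h => hs h.2)
    (fun h => absurd (Finset.mem_univ _) h)

end Blocks

/-! ### Factorization by `V`, the kernel, and the inverse of `F_b`. -/

section Matrices

variable {a b : ℕ → ℝ} {m N p : ℕ} {n : Fin (p + 1) → ℕ} {h : Fin p → ℤ} {cb ca : ℂ} {Rb Ra : ℝ}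

lemma EnclosesB.regular (hγ : EnclosesB a b m N cb Rb) :
    ∀ z ∈ Metric.closedBall cb Rb, Regular a m z := fun _ hz =>
  ⟨fun h => hγ.zero_outside (h ▸ hz), fun k h1 h2 h => hγ.outside k h1 h2 (h ▸ hz)⟩

lemma EnclosesA.regular (hγ : EnclosesA a b m N h ca Ra) :
    ∀ z ∈ Metric.sphere ca Ra, Regular a m z := fun z hz =>
  ⟨fun h0 => by
    subst h0
    rcases hγ.zero with h1 | h1
    · exact notMem_sphere_of_mem_ball h1 hz
    · exact notMem_sphere_of_notMem h1.1 hz,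
    fun k h1 h2 h => notMem_sphere_of_mem_ball (hγ.inside k h1 h2) (h ▸ hz)⟩

lemma exists_enclosesAll (hab : Parameters a b) (N : ℕ) : ∃ R, EnclosesAll a b N R := by
  have hnn : ∀ k ∈ Finset.Icc 1 N, 0 ≤ 1 / b k := fun k hk =>
    (one_div_pos.2 (hab.b_pos (Finset.mem_Icc.1 hk).1)).le
  have hsum := Finset.sum_nonneg hnn
  refine ⟨2 + ∑ k ∈ Finset.Icc 1 N, 1 / b k, by linarith, fun k h1 h2 => ?_, fun k h1 => ?_⟩
  · have hk := Finset.mem_Icc.2 ⟨h1, h2⟩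
    have := Finset.single_le_sum hnn hk
    rw [mem_ball_zero_iff, ← Complex.ofReal_one, ← Complex.ofReal_div, Complex.norm_real,
      Real.norm_of_nonneg (hnn k hk)]
    linarith
  · have := (hab.a_mem k h1).2
    rw [mem_ball_zero_iff, Complex.norm_real, Real.norm_of_nonneg (hab.a_mem k h1).1]
    linarith

lemma FbEntry_eq (x : ℕ → ℤ) (hx : x = 0) (c : ℂ) (R : ℝ) (i j : ℕ) :
    FbEntry a b m n h x c R i j = entry a b c R m (level n h j) i j := by
  subst hx
  unfold FbEntry entry divDiff coeff core
  rw [← contour_const_mul]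
  congr 1
  funext z
  rw [Pi.zero_apply, zpow_zero, div_one, mul_zpow, Finset.prod_div_distrib]
  ring

lemma VEntry_eq (i j : ℕ) : VEntry a b m n h cb Rb i j =
    (coeff a b m (level n h i) i)⁻¹ * divDiff b cb Rb (fun z => (core a m (level n h i) z)⁻¹) i j := by
  unfold VEntry divDiff coeff core
  rw [← contour_const_mul]
  congr 1
  funext z
  rw [show 1 - level n h i = -(level n h i - 1) by ring, zpow_neg, mul_zpow,
    Finset.prod_div_distrib]
  simp only [inv_div, mul_inv]
  ring

/-- The normalization is chosen for this: it makes the diagonals of `Fb` and `V` equal to one. -/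
lemma coeff_mul_core (hab : Parameters a b) {j : ℕ} (hj : 1 ≤ j) (h : ℤ) :
    coeff a b m h j * core a m h (1 / (b j : ℂ)) = 1 := by
  have h1 : coeff a b m h j ≠ 0 := coeff_ne_zero hab hj
  have h2 : core a m h (1 / (b j : ℂ)) = (coeff a b m h j)⁻¹ := by
    unfold core coeff
    simp only [one_div, div_inv_eq_mul, inv_zpow, mul_inv]
    rw [div_eq_mul_inv]
  rw [h2, mul_inv_cancel₀ h1]

lemma differentiableOn_core_inv {s : Set ℂ} {h : ℤ} (hs : ∀ z ∈ s, Regular a m z) :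
    DifferentiableOn ℂ (fun z => (core a m h z)⁻¹) s :=
  (differentiableOn_core hs).fun_inv fun z hz =>
    div_ne_zero (zpow_ne_zero _ (hs z hz).ne_zero) (hs z hz).prod_ne_zero

lemma Fb_of_lt (hγ : EnclosesB a b m N cb Rb) {i j : Fin N} (hij : i < j) :
    Fb a b m N n h 0 cb Rb i j = 0 := by
  have hij' : (i : ℕ) < j := hij
  simp only [Fb, Matrix.of_apply, FbEntry_eq 0 rfl, entry]
  rw [divDiff_of_lt hγ.pos hγ.inside (differentiableOn_core hγ.regular) (by omega) (by omega),
    mul_zero]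

lemma Fb_self (hab : Parameters a b) (hγ : EnclosesB a b m N cb Rb) (i : Fin N) :
    Fb a b m N n h 0 cb Rb i i = 1 := by
  simp only [Fb, Matrix.of_apply, FbEntry_eq 0 rfl, entry]
  rw [divDiff_self hγ.pos hγ.inside (differentiableOn_core hγ.regular) (by omega) (by omega),
    coeff_mul_core hab (by omega)]

lemma V_of_lt (hγ : EnclosesB a b m N cb Rb) {i j : Fin N} (hij : i < j) :
    V a b m N n h cb Rb i j = 0 := by
  have hij' : (i : ℕ) < j := hij
  simp only [V, Matrix.of_apply, VEntry_eq]
  rw [divDiff_of_lt hγ.pos hγ.inside (differentiableOn_core_inv hγ.regular) (by omega) (by omega),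
    mul_zero]

lemma V_self (hab : Parameters a b) (hγ : EnclosesB a b m N cb Rb) (i : Fin N) :
    V a b m N n h cb Rb i i = 1 := by
  simp only [V, Matrix.of_apply, VEntry_eq]
  rw [divDiff_self hγ.pos hγ.inside (differentiableOn_core_inv hγ.regular) (by omega) (by omega),
    ← mul_inv, coeff_mul_core hab (by omega), inv_one]

lemma det_V (hab : Parameters a b) (hγ : EnclosesB a b m N cb Rb) :
    (V a b m N n h cb Rb).det = 1 := by
  rw [Matrix.det_of_isLowerTriangular _ fun i j hij => V_of_lt hγ hij]
  exact Finset.prod_eq_one fun i _ => V_self hab hγ i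

lemma sum_fin_succ_eq_sum_Icc (f : ℕ → ℂ) (N : ℕ) :
    ∑ k : Fin N, f (k + 1) = ∑ k ∈ Finset.Icc 1 N, f k := by
  induction N with
  | zero => simp
  | succ N ih => rw [Fin.sum_univ_castSucc, Finset.sum_Icc_succ_top (by omega), ← ih]; rfl

lemma L_apply (hn : StrictMono n) {r s : Fin p} {i j : Fin N}
    (hi : (i : ℕ) + 1 ∈ block n r) (hj : (j : ℕ) + 1 ∈ block n s) :
    L a b m N n h cb Rb i j = coeff a b m (h s) (j + 1) / coeff a b m (h r) (i + 1) *
      if s < r then singleIntegral b cb Rb (h r) (h s) (i + 1) (j + 1) else 0 := by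
  classical
  simp only [L, Matrix.of_apply]
  rw [sum_sum_eq_of_unique r s]
  · simp only [hi, hj, and_true]
    simp only [columnFactor, level_eq hn hi, level_eq hn hj, coeff]
  · intro r' s' hne
    exact if_neg fun hc => hne ⟨block_unique hn hc.2.1 hi, block_unique hn hc.2.2 hj⟩

lemma kernel_apply (hn : StrictMono n) {r s : Fin p} {i j : Fin N}
    (hi : (i : ℕ) + 1 ∈ block n r) (hj : (j : ℕ) + 1 ∈ block n s) :
    kernel a b m N n h ca Ra cb Rb i j =
      (if s < r then singleIntegral b cb Rb (h r) (h s) (i + 1) (j + 1) else 0) +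
        doubleIntegral a b m ca Ra cb Rb (h r) (h s) (i + 1) (j + 1) := by
  classical
  simp only [kernel, Matrix.of_apply, kernelBlock]
  rw [sum_sum_eq_of_unique r s]
  · rw [if_pos ⟨hi, hj⟩]
  · intro r' s' hne
    exact if_neg fun hc => hne ⟨block_unique hn hc.1 hi, block_unique hn hc.2 hj⟩

/-- The level in `V` depends only on the row and that in `Fb` only on the column, so each entry of
the product falls under the Leibniz rule; the factors with the `a_k` cancel and `z ^ (h s - h r)` is
left. -/
lemma V_mul_Fb (hab : Parameters a b) (hn : StrictMono n) (hn0 : n 0 = 0)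
    (hnN : n (Fin.last p) = N) (hγ : EnclosesB a b m N cb Rb) :
    V a b m N n h cb Rb * Fb a b m N n h 0 cb Rb = 1 + L a b m N n h cb Rb := by
  ext i j
  obtain ⟨r, hr⟩ := exists_mem_block hn0 hnN (j := i + 1) (by omega) (by omega)
  obtain ⟨s, hs⟩ := exists_mem_block hn0 hnN (j := j + 1) (by omega) (by omega)
  have hprod : (V a b m N n h cb Rb * Fb a b m N n h 0 cb Rb) i j =
      coeff a b m (h s) (j + 1) / coeff a b m (h r) (i + 1) *
        divDiff b cb Rb (fun z => z ^ (h s - h r)) (i + 1) (j + 1) := by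
    simp only [Matrix.mul_apply, V, Fb, Matrix.of_apply, VEntry_eq, FbEntry_eq 0 rfl, entry,
      level_eq hn hr, level_eq hn hs]
    -- The Leibniz rule sums over `k ≤ i + 1` only; the other terms vanish because `V` is lower
    -- triangular.
    rw [sum_fin_succ_eq_sum_Icc fun k => (coeff a b m (h r) (i + 1))⁻¹ *
      divDiff b cb Rb (fun z => (core a m (h r) z)⁻¹) (i + 1) k *
        (coeff a b m (h s) (j + 1) * divDiff b cb Rb (core a m (h s)) k (j + 1)),
      ← Finset.sum_subset (Finset.Icc_subset_Icc_right (show (i : ℕ) + 1 ≤ N from i.2))]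
    · have key := sum_divDiff_mul_divDiff hγ.pos hγ.inside
        (differentiableOn_core_inv (h := h r) hγ.regular)
        (differentiableOn_core (h := h s) hγ.regular) (i := i + 1) i.2 (j + 1)
      have hpow : divDiff b cb Rb (fun z => z ^ (h s - h r)) (i + 1) (j + 1) =
          divDiff b cb Rb (fun z => (core a m (h r) z)⁻¹ * core a m (h s) z) (i + 1) (j + 1) := by
        refine contour_congr hγ.pos fun z hz => ?_
        have hz' := hγ.regular z (Metric.sphere_subset_closedBall hz)
        have h1 := hz'.prod_ne_zero
        have h2 : z ^ (h s - h r) = (z ^ (h r - 1))⁻¹ * z ^ (h s - 1) := by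
          rw [← zpow_neg, ← zpow_add₀ hz'.ne_zero]
          congr 1
          ring
        simp only [core, inv_div, h2]
        field_simp
      rw [hpow, ← key, Finset.mul_sum]
      exact Finset.sum_congr rfl fun k _ => by ring
    · intro k hk hk'
      rw [Finset.mem_Icc] at hk hk'
      rw [divDiff_of_lt hγ.pos hγ.inside (differentiableOn_core_inv hγ.regular) (by omega)
        (show (i : ℕ) + 1 ≤ N from i.2)]
      ring
  have hpowd : DifferentiableOn ℂ (fun z : ℂ => z ^ (h s - h r)) (Metric.closedBall cb Rb) :=
    fun z hz => (differentiableAt_id.zpow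
      (Or.inl (hγ.regular z hz).ne_zero)).differentiableWithinAt
  rw [hprod, Matrix.add_apply, L_apply hn hr hs]
  -- Above the block diagonal the divided difference vanishes, inside a block the power is 1 and
  -- gives the identity, and below it is the integral defining `L`.
  rcases lt_trichotomy r s with hrs | rfl | hrs
  · have hlt := lt_of_mem_block hn hrs hr hs
    rw [divDiff_of_lt hγ.pos hγ.inside hpowd hlt (by omega), if_neg hrs.not_gt,
      Matrix.one_apply_ne (fun h => by subst h; omega)]
    ring
  · simp only [sub_self, zpow_zero, lt_irrefl, if_false, mul_zero, add_zero]
    rcases lt_trichotomy (i : ℕ) j with hij | hij | hij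
    · rw [divDiff_of_lt hγ.pos hγ.inside (differentiableOn_const _) (by omega) (by omega),
        Matrix.one_apply_ne (fun h => by subst h; omega), mul_zero]
    · obtain rfl := Fin.ext hij
      rw [divDiff_self hγ.pos hγ.inside (differentiableOn_const _) (by omega) (by omega),
        Matrix.one_apply_eq, div_self (coeff_ne_zero hab (by omega)), mul_one]
    · rw [divDiff_one_of_lt hγ.pos hγ.inside (by omega) (by omega) (by omega),
        Matrix.one_apply_ne (fun h => by subst h; omega), mul_zero]
  · have hlt := lt_of_mem_block hn hrs hs hr
    rw [if_pos hrs, Matrix.one_apply_ne (fun h => by subst h; omega), zero_add]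
    congr 1
    refine contour_congr hγ.pos fun z hz => ?_
    have h1 := (show NodesInside b N cb Rb from hγ.inside).bProd_ne_zero
      (show (j : ℕ) ≤ N from j.2.le) hz
    have h2 : bProd b (i + 1) z = bProd b j z *
        ∏ k ∈ Finset.Icc ((j : ℕ) + 1) (i + 1), (z - 1 / (b k : ℂ)) := by
      rw [← bProd_mul_prod_Ioc (show (j : ℕ) ≤ i + 1 by omega) z]
      congr 2
      ext k
      simp only [Finset.mem_Ioc, Finset.mem_Icc, Nat.succ_le_iff]
    simp only [Nat.add_sub_cancel, h2, Finset.prod_inv_distrib]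
    rw [div_mul_eq_div_div, div_self h1, one_div, mul_comm]

/-- `Fb` is taken here over `γ_a`, so that summing over the intermediate index produces the Cauchy
kernel of the double integral. -/
lemma V_mul_entries_a (hn : StrictMono n) (hγb : EnclosesB a b m N cb Rb)
    (hγa : EnclosesA a b m N h ca Ra)
    (hdisj : Disjoint (Metric.closedBall ca Ra) (Metric.closedBall cb Rb)) {r s : Fin p}
    {i j : Fin N} (hr : (i : ℕ) + 1 ∈ block n r) (hs : (j : ℕ) + 1 ∈ block n s) :
    (V a b m N n h cb Rb * Fb a b m N n h 0 ca Ra) i j =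
      coeff a b m (h s) (j + 1) / coeff a b m (h r) (i + 1) *
        doubleIntegral a b m ca Ra cb Rb (h r) (h s) (i + 1) (j + 1) := by
  have hdouble : doubleIntegral a b m ca Ra cb Rb (h r) (h s) (i + 1) (j + 1) =
      contour cb Rb fun ζ => contour ca Ra fun z => (core a m (h r) ζ)⁻¹ * core a m (h s) z *
        (bProd b (j + 1 - 1) z / bProd b (i + 1) ζ) * (1 / (z - ζ)) := by
    unfold doubleIntegral core
    congr 1
    funext ζ
    congr 1
    funext z
    rw [Finset.prod_div_distrib, inv_div]
    ring
  rw [hdouble, ← sum_divDiff_mul_divDiff_of_disjoint hγb.pos hγa.pos hγb.inside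
    (fun z hz k h1 h2 h => notMem_sphere_of_notMem (hγa.outside k h1 h2) (h ▸ hz)) hdisj
    (differentiableOn_core_inv hγb.regular)
    (differentiableOn_core hγa.regular).continuousOn i.2 (j + 1)]
  simp only [Matrix.mul_apply, V, Fb, Matrix.of_apply, VEntry_eq, FbEntry_eq 0 rfl, entry,
    level_eq hn hr, level_eq hn hs]
  rw [sum_fin_succ_eq_sum_Icc fun k => (coeff a b m (h r) (i + 1))⁻¹ *
    divDiff b cb Rb (fun z => (core a m (h r) z)⁻¹) (i + 1) k *
      (coeff a b m (h s) (j + 1) * divDiff b ca Ra (core a m (h s)) k (j + 1)), Finset.mul_sum]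
  exact Finset.sum_congr rfl fun k _ => by ring

/-- The three integrals are sums of the same residues `ρ`, and each pole lies in exactly one of the
two small discs. -/
lemma entry_eq_add {R : ℝ} (hR : EnclosesAll a b N R) (hγb : EnclosesB a b m N cb Rb)
    (hγa : EnclosesA a b m N h ca Ra) (s : Fin p)
    {i : ℕ} (hi : i ≤ N) (j : ℕ) :
    entry a b 0 R m (h s) i j = entry a b cb Rb m (h s) i j + entry a b ca Ra m (h s) i j := by
  classical
  obtain ⟨ρ, hρ, -⟩ := exists_residues (poles a b m (h s) i).toFinset (poles a b m (h s) i)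
    (fun p hp => by simpa using hp) (numerator b m (h s) j)
  have hsplit : ∀ q ∈ poles a b m (h s) i,
      (q ∈ Metric.ball cb Rb ∧ q ∉ Metric.closedBall ca Ra) ∨
        (q ∈ Metric.ball ca Ra ∧ q ∉ Metric.closedBall cb Rb) := by
    intro q hq
    rcases mem_poles.1 hq with ⟨k, h1, h2, rfl⟩ | ⟨k, h1, h2, rfl⟩ | ⟨h1, rfl⟩
    · exact Or.inl ⟨hγb.inside k h1 (h2.trans hi), hγa.outside k h1 (h2.trans hi)⟩
    · exact Or.inr ⟨hγa.inside k h1 h2, hγb.outside k h1 h2⟩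
    -- The origin is a pole only when `h s ≤ -m`, which rules out that `γ_a` leaves it outside.
    · refine Or.inr ⟨hγa.zero.resolve_right fun h2 => ?_, hγb.zero_outside⟩
      have := h2.2 s
      omega
  have e0 := hρ 0 R hR.pos fun q hq =>
    notMem_sphere_of_mem_ball (hR.poles_mem hi (by simpa using hq))
  have eb := hρ cb Rb hγb.pos fun q hq => (hsplit q (by simpa using hq)).elim
    (fun h => notMem_sphere_of_mem_ball h.1) fun h => notMem_sphere_of_notMem h.2
  have ea := hρ ca Ra hγa.pos fun q hq => (hsplit q (by simpa using hq)).elim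
    (fun h => notMem_sphere_of_notMem h.2) fun h => notMem_sphere_of_mem_ball h.1
  have key : divDiff b 0 R (core a m (h s)) i j =
      divDiff b cb Rb (core a m (h s)) i j + divDiff b ca Ra (core a m (h s)) i j := by
    unfold divDiff
    rw [contour_congr hR.pos fun z hz => core_mul_eq (hR.regular 0 z hz).ne_zero i j,
      contour_congr hγb.pos fun z hz => core_mul_eq
        (hγb.regular z (Metric.sphere_subset_closedBall hz)).ne_zero i j,
      contour_congr hγa.pos fun z hz => core_mul_eq (hγa.regular z hz).ne_zero i j,
      e0, eb, ea, ← Finset.sum_add_distrib]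
    refine Finset.sum_congr rfl fun q hq => ?_
    have hq : q ∈ poles a b m (h s) i := by simpa using hq
    rw [Set.indicator_of_mem (hR.poles_mem hi hq)]
    rcases hsplit q hq with h1 | h1
    · rw [Set.indicator_of_mem h1.1,
        Set.indicator_of_notMem fun h => h1.2 (Metric.ball_subset_closedBall h), add_zero]
    · rw [Set.indicator_of_mem h1.1,
        Set.indicator_of_notMem fun h => h1.2 (Metric.ball_subset_closedBall h), zero_add]
  unfold entry
  rw [key, mul_add]

lemma transMatrix_eq_add {R : ℝ} (hn : StrictMono n) (hn0 : n 0 = 0) (hnN : n (Fin.last p) = N)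
    (hR : EnclosesAll a b N R) (hγb : EnclosesB a b m N cb Rb) (hγa : EnclosesA a b m N h ca Ra) :
    transMatrix a b N R (fun _ => m) (level n h) =
      Fb a b m N n h 0 cb Rb + Fb a b m N n h 0 ca Ra := by
  ext i j
  obtain ⟨s, hs⟩ := exists_mem_block hn0 hnN (j := j + 1) (by omega) (by omega)
  simp only [transMatrix, Fb, Matrix.of_apply, Matrix.add_apply, FbEntry_eq 0 rfl, level_eq hn hs]
  exact entry_eq_add hR hγb hγa s i.2 _

/-- `1 + F` is the conjugate of `V * transMatrix` by the diagonal matrix of the normalizing factors,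
and `V` is unitriangular. -/
lemma det_one_add_kernel {R : ℝ} (hab : Parameters a b) (hn : StrictMono n) (hn0 : n 0 = 0)
    (hnN : n (Fin.last p) = N) (hR : EnclosesAll a b N R) (hγb : EnclosesB a b m N cb Rb)
    (hγa : EnclosesA a b m N h ca Ra)
    (hdisj : Disjoint (Metric.closedBall ca Ra) (Metric.closedBall cb Rb)) :
    (1 + kernel a b m N n h ca Ra cb Rb).det =
      (transMatrix a b N R (fun _ => m) (level n h)).det := by
  set C : Matrix (Fin N) (Fin N) ℂ :=
    Matrix.diagonal fun j => coeff a b m (level n h (j + 1)) (j + 1) with hC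
  have hCdet : C.det ≠ 0 := by
    rw [hC, Matrix.det_diagonal, Finset.prod_ne_zero_iff]
    exact fun j _ => coeff_ne_zero hab (by omega)
  have key : (1 + kernel a b m N n h ca Ra cb Rb) * C = C * (V a b m N n h cb Rb *
      transMatrix a b N R (fun _ => m) (level n h)) := by
    rw [transMatrix_eq_add hn hn0 hnN hR hγb hγa, mul_add, V_mul_Fb hab hn hn0 hnN hγb]
    ext i j
    obtain ⟨r, hr⟩ := exists_mem_block hn0 hnN (j := i + 1) (by omega) (by omega)
    obtain ⟨s, hs⟩ := exists_mem_block hn0 hnN (j := j + 1) (by omega) (by omega)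
    rw [hC, Matrix.mul_diagonal, Matrix.diagonal_mul, Matrix.add_apply, Matrix.add_apply,
      Matrix.add_apply, V_mul_entries_a hn hγb hγa hdisj hr hs, kernel_apply hn hr hs,
      L_apply hn hr hs, level_eq hn hr, level_eq hn hs]
    have h1 : coeff a b m (h r) (i + 1) ≠ 0 := coeff_ne_zero hab (by omega)
    by_cases hij : i = j
    · subst hij
      obtain rfl := block_unique hn hr hs
      field_simp
      ring
    · rw [Matrix.one_apply_ne hij]
      field_simp
      ring
  have hdet := congrArg Matrix.det key
  rw [Matrix.det_mul, Matrix.det_mul, Matrix.det_mul, det_V hab hγb, one_mul, mul_comm] at hdet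
  exact mul_left_cancel₀ hCdet hdet

/-- The entries of the powers of `L` vanish unless the row block is later by the exponent. -/
lemma neg_L_pow_apply_eq_zero (hn : StrictMono n) (hn0 : n 0 = 0) (hnN : n (Fin.last p) = N)
    (l : ℕ) {r s : Fin p} {i j : Fin N} (hr : (i : ℕ) + 1 ∈ block n r)
    (hs : (j : ℕ) + 1 ∈ block n s) (hrs : (r : ℕ) < s + l) :
    ((-L a b m N n h cb Rb) ^ l) i j = 0 := by
  induction l generalizing s j with
  | zero =>
    rw [pow_zero, Matrix.one_apply_ne]
    rintro rfl
    obtain rfl := block_unique hn hr hs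
    omega
  | succ l ih =>
    rw [pow_succ, Matrix.mul_apply]
    refine Finset.sum_eq_zero fun k _ => ?_
    obtain ⟨t, ht⟩ := exists_mem_block hn0 hnN (j := k + 1) (by omega) (by omega)
    by_cases hst : s < t
    · have hst' : (s : ℕ) < t := hst
      rw [ih ht (by omega), zero_mul]
    · rw [Matrix.neg_apply, L_apply hn ht hs, if_neg hst]
      ring

/-- `V * Fb = 1 + L`, and since `L` is nilpotent of order at most `p` a finite geometric series
inverts the right side. -/
lemma inv_Fb (hab : Parameters a b) (hn : StrictMono n) (hn0 : n 0 = 0)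
    (hnN : n (Fin.last p) = N) (hγ : EnclosesB a b m N cb Rb) :
    (Fb a b m N n h 0 cb Rb)⁻¹ =
      (∑ l ∈ Finset.range p, (-L a b m N n h cb Rb) ^ l) * V a b m N n h cb Rb := by
  apply Matrix.inv_eq_left_inv
  have hL : (-L a b m N n h cb Rb) ^ p = 0 := by
    ext i j
    obtain ⟨r, hr⟩ := exists_mem_block hn0 hnN (j := i + 1) (by omega) (by omega)
    obtain ⟨s, hs⟩ := exists_mem_block hn0 hnN (j := j + 1) (by omega) (by omega)
    exact neg_L_pow_apply_eq_zero hn hn0 hnN p hr hs (by omega)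
  have hgeom := geom_sum_mul_neg (-L a b m N n h cb Rb) p
  rw [sub_neg_eq_add, hL, sub_zero] at hgeom
  rw [mul_assoc, V_mul_Fb hab hn hn0 hnN hγ, hgeom]

/-- For `l ≥ 1`, `(-L) ^ l` needs the intermediate block strictly before that of `i`, while `V`
needs it not before that of `j`; with `r ≤ s` no index satisfies both. -/
lemma inv_Fb_apply (hab : Parameters a b) (hn : StrictMono n) (hn0 : n 0 = 0)
    (hnN : n (Fin.last p) = N) (hγ : EnclosesB a b m N cb Rb) {r s : Fin p} (hrs : r ≤ s)
    {i j : Fin N} (hi : (i : ℕ) + 1 ∈ block n r) (hj : (j : ℕ) + 1 ∈ block n s) :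
    (Fb a b m N n h 0 cb Rb)⁻¹ i j = V a b m N n h cb Rb i j := by
  rw [inv_Fb hab hn hn0 hnN hγ, Finset.sum_mul, Matrix.sum_apply,
    Finset.sum_eq_single_of_mem 0 (Finset.mem_range.2 (by have := r.2; omega)), pow_zero, one_mul]
  intro l _ hl
  rw [Matrix.mul_apply]
  refine Finset.sum_eq_zero fun k _ => ?_
  obtain ⟨t, ht⟩ := exists_mem_block hn0 hnN (j := k + 1) (by omega) (by omega)
  by_cases htr : t < s
  · have := lt_of_mem_block hn htr ht hj
    rw [V_of_lt hγ (show k < j from Fin.lt_def.2 (by omega)), mul_zero]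
  · have h1 : (r : ℕ) ≤ s := hrs
    have h2 : (s : ℕ) ≤ t := not_lt.1 htr
    rw [neg_L_pow_apply_eq_zero hn hn0 hnN l hi ht (by omega), zero_mul]

end Matrices

end PNG

theorem mainTheorem7 {Ω : Type*} [MeasurableSpace Ω] (μ : Measure Ω) [IsProbabilityMeasure μ]
    (a b : ℕ → ℝ) (hab : PNG.Parameters a b)
    (W : ℕ → ℕ → Ω → ℕ) (hW : PNG.GeometricEnvironment μ a b W)
    (m N p : ℕ) (n : Fin (p + 1) → ℕ) (hn : StrictMono n) (hn_zero : n 0 = 0)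
    (hn_last : n (Fin.last p) = N)
    (h : Fin p → ℤ) (hh : Monotone h)
    (cb : ℂ) (Rb : ℝ) (hγb : PNG.EnclosesB a b m N cb Rb) :
    -- the Fredholm determinant formula, for every admissible choice of the contours
    (∀ (ca : ℂ) (Ra : ℝ), PNG.EnclosesA a b m N h ca Ra →
      Disjoint (Metric.closedBall ca Ra) (Metric.closedBall cb Rb) →
      ((μ.real {u | ∀ k : Fin p,
          PNG.growth 0 (fun i j => W i j u) m (n k.succ) < h k} : ℝ) : ℂ) =
        (1 + PNG.kernel a b m N n h ca Ra cb Rb).det) ∧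
    -- `F_b` is lower triangular with ones on the diagonal
    (∀ i j : Fin N, i < j → PNG.Fb a b m N n h 0 cb Rb i j = 0) ∧
    (∀ i : Fin N, PNG.Fb a b m N n h 0 cb Rb i i = 1) ∧
    -- the inverse of `F_b`
    (PNG.Fb a b m N n h 0 cb Rb)⁻¹ =
      (∑ l ∈ Finset.range p, (-PNG.L a b m N n h cb Rb) ^ l) * PNG.V a b m N n h cb Rb ∧
    (∀ r s : Fin p, r ≤ s → ∀ i j : Fin N,
      (i : ℕ) + 1 ∈ PNG.block n r → (j : ℕ) + 1 ∈ PNG.block n s →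
      (PNG.Fb a b m N n h 0 cb Rb)⁻¹ i j = PNG.V a b m N n h cb Rb i j) := by
  obtain ⟨R, hR⟩ := PNG.exists_enclosesAll hab N
  refine ⟨fun ca Ra hγa hdisj => ?_, fun i j hij => PNG.Fb_of_lt hγb hij,
    fun i => PNG.Fb_self hab hγb i, PNG.inv_Fb hab hn hn_zero hn_last hγb,
    fun r s hrs i j hi hj => PNG.inv_Fb_apply hab hn hn_zero hn_last hγb hrs hi hj⟩
  rw [PNG.setOf_growth_lt_eq hn hn_zero hn_last,
    PNG.det_one_add_kernel hab hn hn_zero hn_last hR hγb hγa hdisj]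
  exact PNG.measureReal_belowEvent hab hW hR m (PNG.level_mono hn hn_zero hn_last hh)
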